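/- Fix integers $k,n\ge 1$. Let $\mathcal P_{k,n}$ be the set of functions $\lambda:\mathbb Z\to\mathbb Z$ with $\lambda_{i+k}=\lambda_i-n$ for all $i$, and let $$\mathcal A_{k,n}=\{\lambda\in\mathcal P_{k,n}\mid n\ge\lambda_1\ge\cdots\ge\lambda_k>0\}.$$ Write $|\lambda|=\lambda_1+\dots+\lambda_k$, let $\tau(m)=m-1$, and for $d\in\mathbb Z$ let $\lambda[d]=\lambda\circ\tau^d$, i.e. $\lambda[d]_i=\lambda_{i-d}$. Every weakly decreasing $L\in\mathcal P_{k,n}$ (a *cylindric loop*) equals $\lambda[d]$ for exactly one pair $(\lambda,d)\in\mathcal A_{k,n}\times\mathbb Z$; its conjugate is $L'_j=\max\{a\in\mathbb Z\mid L_a\ge j\}$. *Weights.* For $\lambda,\mu\in\mathcal A_{k,n}$ and $d\ge 0$ put $$\chi_{\lambda/d/\mu}=\prod_{j=1}^n\binom{\lambda[d]'_j-\mu'_{j+1}}{\mu'_j-\mu'_{j+1}}-\prod_{j=1}^n\binom{\lambda[d-1]'_j-\mu'_{j+1}}{\mu'_j-\mu'_{j+1}},$$ where a binomial coefficient with a negative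 argument is $0$. *Cylindric reverse plane partitions.* Let $\lambda,\mu\in\mathcal A_{k,n}$ and $d\in\mathbb Z_{\ge0}$. If $\mu_i\le\lambda[d]_i$ for all $i$, then a cylindric reverse plane partition $\hat\pi$ of shape $\lambda/d/\mu$ is a map to $\{1,2,\dots\}$ from the set of squares $(i,j)\in\mathbb Z^2$ with $\mu_i<j\le\lambda[d]_i$, such that $\hat\pi(i,j)=\hat\pi(i+k,j-n)$, and $\hat\pi(i,j)\le\hat\pi(i+1,j)$ and $\hat\pi(i,j)\le\hat\pi(i,j+1)$ whenever the squares involved belong to the shape. If $\mu\not\le\lambda[d]$, there are none. For $i\ge0$ the squares with entry at most $i$ are those between $\mu$ and a cylindric loop $\lambda^{(i)}[d_i]$ with $\lambda^{(i)}\in\mathcal A_{k,n}$ (so $\lambda^{(0)}=\mu$, $d_0=0$). Put $$\chi_{\hat\pi}=\prod_{i\ge1}\chi_{\lambda^{(i)}/(d_i-d_{i-1})/\lambda^{(i-1)}},\qquad x^{\hat\pi}=\prod_{i\ge1}x_i^{\theta_i(\hat\pi)},$$ where $\theta_i(\hat\pi)$ is the number of squares $(a,b)$ with $1\le a\le k$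 and entry $i$. The cylindric complete symmetric function is the formal power series $$h_{\lambda/d/\mu}=\sum_{\hat\pi}\chi_{\hat\pi}\,x^{\hat\pi}$$ in $x_1,x_2,\dots$, summed over all cylindric reverse plane partitions of shape $\lambda/d/\mu$. *Coefficients.* Let $\mathcal P_k^+=\{\nu\in\mathbb Z^k\mid\nu_1\ge\cdots\ge\nu_k\ge0\}$. For a weight $\mu\in\mathbb Z^k$ and $w\in S_k$ let $\mu\circ w=(\mu_{w(1)},\dots,\mu_{w(k)})$, let $S_\mu$ be the stabiliser of $\mu$ in $S_k$, and let $S^\mu$ be the set of minimal length representatives of the right cosets $S_\mu w$. An element of $\mathcal P_{k,n}$ is regarded as a weight through its values on $1,\dots,k$. For $\alpha\in\mathbb Z^k$ let $y^\alpha=y_1^{\alpha_1}\circ\cdots\circ y_k^{\alpha_k}$, where the bijections $y_i$ of $\mathbb Z$ are given by $y_k=\tau\circ\sigma_1\circ\cdots\circ\sigma_{k-1}$ and $y_i=\sigma_i\circ y_{i+1}\circ\sigma_i$, with $\sigma_i$ exchanging $m$ and $m+1$ for all $m\equiv i\bmod k$ (so that $(\lambda\circ y^\alpha)_i=\lambda_i+n\alpha_i$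 for $1\le i\le k$). Put $|\alpha|=\alpha_1+\dots+\alpha_k$. **Theorem.** Let $\lambda,\mu\in\mathcal A_{k,n}$ and $d\in\mathbb Z_{\ge0}$. Then $h_{\lambda/d/\mu}$ is a symmetric function (of bounded degree, with integer coefficients, in infinitely many variables), and $$h_{\lambda/d/\mu}=\sum_{\nu\in\mathcal P_k^+}N_{\mu\nu}^{\lambda}\,h_\nu,\qquad h_\nu=h_{\nu_1}\cdots h_{\nu_k},$$ where $h_r$ is the complete symmetric function of degree $r$ ($h_0=1$) and $N_{\mu\nu}^\lambda\in\mathbb Z_{\ge0}$ is the cardinality of the set $$\{(w,w')\in S^\mu\times S^\nu\mid \mu\circ w+\nu\circ w'=\lambda\circ y^\alpha\text{ for some }\alpha\in\mathbb Z^k\text{ with }|\alpha|=d\}.$$ Only $\nu$ with $|\nu|=nd+|\lambda|-|\mu|$ occur: $N_{\mu\nu}^\lambda=0$ for all other $\nu$, and the sum may be restricted to these. -/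

import Mathlib

noncomputable section

namespace CylSymm

/-! ### Weights, the finite symmetric group, minimal coset representatives -/

/-- The length of a permutation of `k` letters: its number of inversions. -/
def permLength {k : ℕ} (w : Equiv.Perm (Fin k)) : ℕ :=
  (Finset.univ.filter fun p : Fin k × Fin k => p.1 < p.2 ∧ w p.2 < w p.1).card

/-- The stabiliser `S_μ` of a weight `μ` under the right action `(μ, w) ↦ μ ∘ w`. -/
def weightStabilizer {k : ℕ} (μ : Fin k → ℤ) : Set (Equiv.Perm (Fin k)) :=
  {v | μ ∘ v = μ}

/-- The set `S^μ` of minimal length representatives of the right cosets `S_μ w`. -/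
def minCosetReps {k : ℕ} (μ : Fin k → ℤ) : Set (Equiv.Perm (Fin k)) :=
  {w | ∀ v ∈ weightStabilizer μ, permLength w ≤ permLength (v * w)}

/-! ### The extended affine symmetric group as bijections of `ℤ` -/

/-- The shift `τ : m ↦ m - 1`. -/
def tau : Equiv.Perm ℤ := Equiv.subRight 1

/-- The map underlying the simple reflection `σ_i` (with `i` taken modulo `k`). -/
def sigmaFun (k : ℕ) (i m : ℤ) : ℤ :=
  if (k : ℤ) ∣ m - i then m + 1 else if (k : ℤ) ∣ m - (i + 1) then m - 1 else m

theorem not_dvd_both {k : ℕ} (hk : 2 ≤ k) {a b : ℤ} (hab : a - b = 1)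
    (ha : (k : ℤ) ∣ a) (hb : (k : ℤ) ∣ b) : False := by
  have h1 : (k : ℤ) ∣ 1 := hab ▸ dvd_sub ha hb
  have := Int.le_of_dvd one_pos h1
  omega

theorem sigmaFun_involutive {k : ℕ} (hk : 2 ≤ k) (i : ℤ) :
    Function.Involutive (sigmaFun k i) := by
  intro m
  unfold sigmaFun
  by_cases h1 : (k : ℤ) ∣ m - i
  · have h2 : ¬ (k : ℤ) ∣ m + 1 - i := fun h => not_dvd_both hk (by ring) h h1
    have h3 : (k : ℤ) ∣ m + 1 - (i + 1) := by
      rw [show m + 1 - (i + 1) = m - i by ring]; exact h1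
    simp only [h1, h2, h3, if_true, if_false]; ring
  · by_cases h2 : (k : ℤ) ∣ m - (i + 1)
    · have h3 : (k : ℤ) ∣ m - 1 - i := by
        rw [show m - 1 - i = m - (i + 1) by ring]; exact h2
      simp only [h1, h2, h3, if_true, if_false]; ring
    · simp only [h1, h2, if_false]

/-- The simple reflection `σ_i` as a bijection of `ℤ`. For `k ≤ 1` there are no simple
reflections, and the value is the identity. -/
def sigma (k : ℕ) (i : ℤ) : Equiv.Perm ℤ :=
  if hk : 2 ≤ k then (sigmaFun_involutive hk i).toPerm else 1

/-- `yAux k t` is the generator `y_{k-t}`: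
`y_k = τ ∘ σ_1 ∘ ⋯ ∘ σ_{k-1}` and `y_i = σ_i ∘ y_{i+1} ∘ σ_i`. -/
def yAux (k : ℕ) : ℕ → Equiv.Perm ℤ
  | 0 => tau * ((List.range (k - 1)).map fun i : ℕ => sigma k ((i : ℤ) + 1)).prod
  | t + 1 => sigma k ((k : ℤ) - (t + 1)) * yAux k t * sigma k ((k : ℤ) - (t + 1))

/-- The generators `y_1, …, y_k`; the index `i : Fin k` stands for `i + 1 ∈ {1, …, k}`. -/
def yGen (k : ℕ) (i : Fin k) : Equiv.Perm ℤ := yAux k (k - (i + 1))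

/-- `y^α = y_1^{α_1} ∘ ⋯ ∘ y_k^{α_k}` for `α ∈ ℤ^k`. -/
def yPow (k : ℕ) (α : Fin k → ℤ) : Equiv.Perm ℤ :=
  (List.ofFn fun i => yGen k i ^ α i).prod

/-! ### Cylindric loops and the alcove -/

/-- `P_{k,n}`: functions `λ : ℤ → ℤ` with `λ_{i+k} = λ_i - n`. -/
def quasiPeriodic (k n : ℕ) : Set (ℤ → ℤ) := {lam | ∀ i, lam (i + k) = lam i - n}

/-- The alcove `A_{k,n}`: those `λ ∈ P_{k,n}` with `n ≥ λ_1 ≥ ⋯ ≥ λ_k > 0`. -/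
def alcove (k n : ℕ) : Set (ℤ → ℤ) :=
  {lam | lam ∈ quasiPeriodic k n ∧ lam 1 ≤ n ∧
    (∀ i : ℤ, 1 ≤ i → i < k → lam (i + 1) ≤ lam i) ∧ 0 < lam k}

/-- The values `(λ_1, …, λ_k)` of `λ : ℤ → ℤ`, as a weight. -/
def window (k : ℕ) (lam : ℤ → ℤ) : Fin k → ℤ := fun i => lam ((i : ℤ) + 1)

/-- `|λ| = λ_1 + ⋯ + λ_k`. -/
def weightSize (k : ℕ) (lam : ℤ → ℤ) : ℤ := ∑ i, window k lam i

/-- The loop `λ[d] = λ ∘ τ^d`, that is `λ[d]_i = λ_{i-d}`. -/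
def shiftLoop (lam : ℤ → ℤ) (d : ℤ) : ℤ → ℤ := fun i => lam (i - d)

/-- The conjugate of a cylindric loop `L` (a weakly decreasing element of `P_{k,n}`):
`L'_j` is the largest `a` with `L_a ≥ j`. For `μ ∈ A_{k,n}` this is the conjugate partition
`μ'_j = #{a ∈ [k] | μ_a ≥ j}` for `1 ≤ j ≤ n`, extended by `μ'_{j+n} = μ'_j - k`. -/
def conjLoop (L : ℤ → ℤ) (j : ℤ) : ℤ := sSup {a | j ≤ L a}

/-- The degree of a cylindric loop `L`: the unique `e` such that `L = λ[e]` with `λ ∈ A_{k,n}`,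
which is the largest `a` with `L_a > n`. -/
def loopDegree (n : ℕ) (L : ℤ → ℤ) : ℤ := sSup {a | (n : ℤ) < L a}

/-- The element `λ` of the alcove such that `L = λ[e]`, `e` the degree of `L`. -/
def loopBase (n : ℕ) (L : ℤ → ℤ) : ℤ → ℤ := shiftLoop L (-loopDegree n L)

/-! ### The weights `χ_{λ/d/μ}` -/

/-- Binomial coefficients, zero if one of the arguments is negative. -/
def binom (a b : ℤ) : ℤ := if a < 0 ∨ b < 0 then 0 else (a.toNat.choose b.toNat : ℤ)

/-- `∏_{j=1}^n binom((λ∘τ^d)'_j - μ'_{j+1}, μ'_j - μ'_{j+1})`. -/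
def chiProd (n : ℕ) (lam : ℤ → ℤ) (d : ℤ) (mu : ℤ → ℤ) : ℤ :=
  ∏ j ∈ Finset.Icc (1 : ℤ) n,
    binom (conjLoop (shiftLoop lam d) j - conjLoop mu (j + 1))
      (conjLoop mu j - conjLoop mu (j + 1))

/-- The weight `χ_{λ/d/μ}` in terms of binomial coefficients. -/
def chi (n : ℕ) (lam : ℤ → ℤ) (d : ℤ) (mu : ℤ → ℤ) : ℤ :=
  chiProd n lam d mu - chiProd n lam (d - 1) mu

/-! ### Cylindric reverse plane partitions -/

/-- The set of squares `(i, j)` between the loops `μ[0]` and `λ[d]`. -/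
def cylDiagram (lam : ℤ → ℤ) (d : ℤ) (mu : ℤ → ℤ) : Set (ℤ × ℤ) :=
  {p | mu p.1 < p.2 ∧ p.2 ≤ shiftLoop lam d p.1}

/-- Cylindric reverse plane partitions of shape `λ/d/μ`. The entry `i : ℕ` here stands for the
positive integer `i + 1`. There is none unless `μ[0] ≤ λ[d]`, that is, unless `λ/d/μ` is a
cylindric shape. -/
structure CylRPP (k n : ℕ) (lam : ℤ → ℤ) (d : ℤ) (mu : ℤ → ℤ) where
  /-- the entry in a square of the diagram -/
  entry : cylDiagram lam d mu → ℕ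
  isShape : ∀ i, mu i ≤ shiftLoop lam d i
  periodic : ∀ p q : cylDiagram lam d mu,
    q.1 = (p.1.1 + (k : ℤ), p.1.2 - (n : ℤ)) → entry p = entry q
  down_column : ∀ p q : cylDiagram lam d mu,
    q.1 = (p.1.1 + 1, p.1.2) → entry p ≤ entry q
  along_row : ∀ p q : cylDiagram lam d mu,
    q.1 = (p.1.1, p.1.2 + 1) → entry p ≤ entry q

namespace CylRPP

variable {k n : ℕ} {lam : ℤ → ℤ} {d : ℤ} {mu : ℤ → ℤ}

/-- The number of squares `(a, b)` with `1 ≤ a ≤ k` and entry `i`. -/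
def weight (π : CylRPP k n lam d mu) (i : ℕ) : ℕ :=
  {p : cylDiagram lam d mu | 1 ≤ p.1.1 ∧ p.1.1 ≤ k ∧ π.entry p = i}.ncard

/-- The cylindric loop `λ^{(i)}[d_i]` that bounds `μ` together with the squares whose entry is
`< i` (that is, one of the first `i` possible entries). For `i = 0` it is `μ[0]`, and the squares
with entry `i` are those between `level i` and `level (i + 1)`. -/
def level (π : CylRPP k n lam d mu) (i : ℕ) : ℤ → ℤ := fun a =>
  mu a + ({b : ℤ | ∃ h : (a, b) ∈ cylDiagram lam d mu, π.entry ⟨(a, b), h⟩ < i}.ncard : ℤ)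

/-- `χ_π`, the product over `i ≥ 1` of `χ_{λ^{(i)}/(d_i - d_{i-1})/λ^{(i-1)}}`. All but finitely
many factors are `1`. -/
def chiWeight (π : CylRPP k n lam d mu) : ℤ :=
  ∏ᶠ i : ℕ, chi n (loopBase n (π.level (i + 1)))
    (loopDegree n (π.level (i + 1)) - loopDegree n (π.level i)) (loopBase n (π.level i))

end CylRPP

/-! ### Symmetric functions in the variables `x_1, x_2, …` -/

/-- A symmetric function: a formal power series of bounded degree with integer coefficients in
countably many variables, invariant under all permutations of the variables. The variable with
index `i : ℕ` is `x_{i+1}`. -/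
def IsSymmetricFunction (f : MvPowerSeries ℕ ℤ) : Prop :=
  (∃ D : ℕ, ∀ θ : ℕ →₀ ℕ, D < θ.degree → MvPowerSeries.coeff θ f = 0) ∧
    ∀ (s : Equiv.Perm ℕ) (θ : ℕ →₀ ℕ),
      MvPowerSeries.coeff (θ.mapDomain s) f = MvPowerSeries.coeff θ f

/-- The complete symmetric function `h_r`, the sum of all monomials of degree `r`. -/
def completeH (r : ℕ) : MvPowerSeries ℕ ℤ := fun θ => if θ.degree = r then 1 else 0

/-- `h_ν = h_{ν_1} ⋯ h_{ν_k}`. -/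
def completeHProd {k : ℕ} (ν : Fin k → ℕ) : MvPowerSeries ℕ ℤ := ∏ i, completeH (ν i)

/-- The cylindric complete symmetric function `h_{λ/d/μ} = ∑_π χ_π x^π`: its coefficient at `x^θ`
is the (finite) sum of `χ_π` over the cylindric reverse plane partitions of weight `θ`. -/
def cylindricH (k n : ℕ) (lam : ℤ → ℤ) (d : ℤ) (mu : ℤ → ℤ) : MvPowerSeries ℕ ℤ := fun θ =>
  ∑ᶠ π : {π : CylRPP k n lam d mu // ∀ i, π.weight i = θ i}, π.1.chiWeight

/-- The positive dominant weights `ν_1 ≥ ⋯ ≥ ν_k ≥ 0`. -/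
def positiveDominant (k : ℕ) : Set (Fin k → ℕ) := {ν | Antitone ν}

/-- The cardinality of the set of pairs `(w, w') ∈ S^μ × S^ν` with `μ ∘ w + ν ∘ w' = λ ∘ y^α` for
some `α ∈ ℤ^k` with `|α| = d`. -/
def fusionN (k : ℕ) (lam : ℤ → ℤ) (d : ℤ) (mu : ℤ → ℤ) (ν : Fin k → ℕ) : ℕ :=
  {p : Equiv.Perm (Fin k) × Equiv.Perm (Fin k) |
    p.1 ∈ minCosetReps (window k mu) ∧ p.2 ∈ minCosetReps (fun i => (ν i : ℤ)) ∧
    ∃ α : Fin k → ℤ, ∑ i, α i = d ∧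
      window k mu ∘ p.1 + (fun i => (ν i : ℤ)) ∘ p.2 = window k (lam ∘ yPow k α)}.ncard

/-! ### Basic facts confirming the definitions -/

theorem sigma_apply {k : ℕ} (hk : 2 ≤ k) (i m : ℤ) : sigma k i m = sigmaFun k i m := by
  simp [sigma, hk]

theorem prod_sigma_apply {k : ℕ} (r : ℕ) (hr : r < k) (m : ℤ) :
    ((List.range r).map fun i : ℕ => sigma k ((i : ℤ) + 1)).prod m =
      if (k : ℤ) ∣ m - (r + 1) then m - r else if (m - 1) % k < r then m + 1 else m := by
  induction r generalizing m with
  | zero =>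
    have h0 := Int.emod_nonneg (m - 1) (show (k : ℤ) ≠ 0 by omega)
    simp only [List.range_zero, List.map_nil, List.prod_nil, Equiv.Perm.coe_one, id]
    split_ifs
    · simp
    · push_cast at *; omega
    · rfl
  | succ r ih =>
    have hk : 2 ≤ k := by omega
    rw [List.range_succ, List.map_append, List.prod_append]
    simp only [List.map_cons, List.map_nil, List.prod_cons, List.prod_nil, mul_one,
      Equiv.Perm.mul_apply]
    rw [ih (by omega), sigma_apply hk]
    unfold sigmaFun
    have key : ∀ c : ℤ, 0 ≤ c → c < k → ∀ x : ℤ, ((k : ℤ) ∣ x - c ↔ x % k = c) := by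
      intro c hc hck x
      rw [← Int.emod_emod_of_dvd x dvd_rfl, ← Int.emod_eq_emod_iff_emod_sub_eq_zero.trans
        (Int.dvd_iff_emod_eq_zero).symm, Int.emod_emod, Int.emod_eq_of_lt hc hck]
    have K1 : ∀ x : ℤ, ((k : ℤ) ∣ x - ((r : ℤ) + 1) ↔ (x - 1) % k = r) := fun x => by
      rw [← key r (by omega) (by omega), show x - ((r : ℤ) + 1) = x - 1 - r by ring]
    have K2 : ∀ x : ℤ, ((k : ℤ) ∣ x - ((r : ℤ) + 1 + 1) ↔ (x - 1) % k = r + 1) := fun x => by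
      rw [← key (r + 1) (by omega) (by omega),
        show x - ((r : ℤ) + 1 + 1) = x - 1 - (r + 1) by ring]
    push_cast
    simp only [K1, K2]
    have e1 : (m - 1) % k = r → (m + 1 - 1) % (k : ℤ) = r + 1 := by
      intro h
      rw [← key (r + 1) (by omega) (by omega)]
      rw [← key r (by omega) (by omega)] at h
      rwa [show m + 1 - 1 - ((r : ℤ) + 1) = m - 1 - r by ring]
    have e2 : (m - 1) % k = (r : ℤ) + 1 → (m - 1 - 1) % (k : ℤ) = r := by
      intro h
      rw [← key r (by omega) (by omega)]
      rw [← key (r + 1) (by omega) (by omega)] at h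
      rwa [show m - 1 - 1 - (r : ℤ) = m - 1 - (r + 1) by ring]
    by_cases h1 : (m - 1) % (k : ℤ) = r
    · have := e1 h1
      simp only [h1, this, if_true]
      split_ifs <;> omega
    · by_cases h2 : (m - 1) % (k : ℤ) = r + 1
      · have := e2 h2
        simp only [h2, if_true]
        split_ifs <;> omega
      · simp only [h1, h2, if_false]
        split_ifs <;> omega

theorem yAux_apply {k : ℕ} (t : ℕ) (ht : t < k) (m : ℤ) :
    yAux k t m = if (k : ℤ) ∣ m - (k - t) then m - k else m := by
  induction t generalizing m with
  | zero =>
    have hp := prod_sigma_apply (k := k) (k - 1) (by omega) m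
    have hc : ((k - 1 : ℕ) : ℤ) = (k : ℤ) - 1 := by omega
    have h0 := Int.emod_nonneg (m - 1) (show (k : ℤ) ≠ 0 by omega)
    have h1 := Int.emod_lt_of_pos (m - 1) (show (0 : ℤ) < k by omega)
    rw [hc] at hp
    simp only [yAux, Equiv.Perm.mul_apply, hp, tau, Equiv.subRight_apply]
    have : (k : ℤ) - 1 + 1 = (k : ℤ) - ((0 : ℕ) : ℤ) := by push_cast; ring
    rw [this]
    by_cases hd : (k : ℤ) ∣ m - ((k : ℤ) - ((0 : ℕ) : ℤ))
    · simp only [hd, if_true]; ring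
    · have hne : (m - 1) % k ≠ (k : ℤ) - 1 := by
        intro h
        apply hd
        have h3 := Int.dvd_self_sub_emod (x := m - 1) (m := (k : ℤ))
        rw [h] at h3
        rwa [show m - ((k : ℤ) - ((0 : ℕ) : ℤ)) = m - 1 - ((k : ℤ) - 1) by push_cast; ring]
      have : (m - 1) % (k : ℤ) < k - 1 := by omega
      simp only [hd, this, if_true, if_false]; ring
  | succ t ih =>
    have hk : 2 ≤ k := by omega
    have ih := ih (by omega)
    simp only [yAux, Equiv.Perm.mul_apply, sigma_apply hk, ih]
    unfold sigmaFun
    push_cast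
    generalize hi : (k : ℤ) - (t + 1) = i
    have hi' : (k : ℤ) - t = i + 1 := by omega
    rw [hi']
    by_cases h1 : (k : ℤ) ∣ m - i
    · have h2 : (k : ℤ) ∣ m + 1 - (i + 1) := by
        rwa [show m + 1 - (i + 1) = m - i by ring]
      have h3 : (k : ℤ) ∣ m + 1 - k - (i + 1) := by
        rw [show m + 1 - k - (i + 1) = m - i - k by ring]; exact dvd_sub_self_right.mpr h1
      have h4 : ¬ (k : ℤ) ∣ m + 1 - k - i := fun h => not_dvd_both hk (by ring) h h3
      simp only [h1, h2, h3, h4, if_true, if_false]; ring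
    · by_cases h2 : (k : ℤ) ∣ m - (i + 1)
      · have h3 : (k : ℤ) ∣ m - 1 - i := by
          rwa [show m - 1 - i = m - (i + 1) by ring]
        have h4 : ¬ (k : ℤ) ∣ m - 1 - (i + 1) := fun h => not_dvd_both hk (by ring) h3 h
        simp only [h1, h2, h3, h4, if_true, if_false]; ring
      · simp only [h1, h2, if_false]

theorem yGen_apply {k : ℕ} (i : Fin k) (m : ℤ) :
    yGen k i m = if (k : ℤ) ∣ m - (i + 1) then m - k else m := by
  have hi := i.2
  rw [yGen, yAux_apply _ (by omega)]
  have : (k : ℤ) - ((k - ((i : ℕ) + 1) : ℕ) : ℤ) = (i : ℤ) + 1 := by omega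
  rw [this]

theorem yGen_zpow_apply {k : ℕ} (i : Fin k) (a m : ℤ) :
    (yGen k i ^ a) m = if (k : ℤ) ∣ m - (i + 1) then m - k * a else m := by
  induction a generalizing m with
  | zero => simp
  | succ a ih =>
    rw [zpow_add_one, Equiv.Perm.mul_apply, ih, yGen_apply]
    by_cases h : (k : ℤ) ∣ m - (i + 1)
    · have h' : (k : ℤ) ∣ m - k - (i + 1) := by
        rw [show m - k - ((i : ℤ) + 1) = m - (i + 1) - k by ring]
        exact dvd_sub_self_right.mpr h
      simp only [h, h', if_true]; ring
    · simp only [h, if_false]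
  | pred a ih =>
    rw [zpow_sub_one, Equiv.Perm.mul_apply]
    have hinv : (yGen k i)⁻¹ m = if (k : ℤ) ∣ m - (i + 1) then m + k else m := by
      rw [Equiv.Perm.inv_eq_iff_eq, yGen_apply]
      by_cases h : (k : ℤ) ∣ m - (i + 1)
      · have h' : (k : ℤ) ∣ m + k - (i + 1) := by
          rw [show m + k - ((i : ℤ) + 1) = m - (i + 1) + k by ring]
          exact dvd_add_self_right.mpr h
        simp only [h, h', if_true]; ring
      · simp only [h, if_false]
    rw [hinv, ih]
    by_cases h : (k : ℤ) ∣ m - (i + 1)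
    · have h' : (k : ℤ) ∣ m + k - (i + 1) := by
        rw [show m + k - ((i : ℤ) + 1) = m - (i + 1) + k by ring]
        exact dvd_add_self_right.mpr h
      simp only [h, h', if_true]; ring
    · simp only [h, if_false]

theorem yPow_list_apply {k : ℕ} (α : Fin k → ℤ) (l : List (Fin k)) (hl : l.Nodup) (j : Fin k)
    (m : ℤ) (hm : (k : ℤ) ∣ m - (j + 1)) :
    (l.map fun i => yGen k i ^ α i).prod m = if j ∈ l then m - k * α j else m := by
  induction l with
  | nil => simp
  | cons i l ih =>
    rw [List.nodup_cons] at hl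
    simp only [List.map_cons, List.prod_cons, Equiv.Perm.mul_apply, ih hl.2, yGen_zpow_apply]
    by_cases hij : i = j
    · subst hij
      simp [hl.1, hm]
    · have hnd : ∀ x : ℤ, (k : ℤ) ∣ x - (j + 1) → ¬ (k : ℤ) ∣ x - (i + 1) := by
        intro x hx hx'
        have h1 : (k : ℤ) ∣ (i : ℤ) - j := by
          have := dvd_sub hx hx'
          rwa [show x - ((j : ℤ) + 1) - (x - (i + 1)) = (i : ℤ) - j by ring] at this
        have h2 := Int.eq_zero_of_abs_lt_dvd h1 (by rw [abs_lt]; omega)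
        exact hij (Fin.ext (by omega))
      have hji : ¬ j = i := fun h => hij h.symm
      by_cases hj : j ∈ l
      · have : (k : ℤ) ∣ m - k * α j - (j + 1) := by
          rw [show m - k * α j - ((j : ℤ) + 1) = m - (j + 1) - k * α j by ring]
          exact dvd_sub hm (dvd_mul_right _ _)
        simp [hj, hnd _ this]
      · simp [hj, hji, hnd _ hm]

theorem yPow_apply {k : ℕ} (α : Fin k → ℤ) (j : Fin k) :
    yPow k α ((j : ℤ) + 1) = (j : ℤ) + 1 - k * α j := by
  rw [yPow, List.ofFn_eq_map, yPow_list_apply α _ (List.nodup_finRange k) j _ (by simp)]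
  simp

theorem quasiPeriodic_sub_mul {k n : ℕ} {lam : ℤ → ℤ} (h : lam ∈ quasiPeriodic k n) (i a : ℤ) :
    lam (i - k * a) = lam i + n * a := by
  have h' : ∀ i, lam (i + k) = lam i - n := h
  induction a with
  | zero => simp
  | succ a ih =>
    have := h' (i - k * ((a : ℤ) + 1))
    rw [show i - k * ((a : ℤ) + 1) + k = i - k * a by ring, ih] at this
    linarith
  | pred a ih =>
    have := h' (i - k * (-(a : ℤ)))
    rw [ih] at this
    rw [show i - k * (-(a : ℤ) - 1) = i - k * (-(a : ℤ)) + k by ring, this]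
    ring

/-- `λ ∘ y^α` is the translate `λ + n α`. -/
theorem window_comp_yPow {k n : ℕ} {lam : ℤ → ℤ} (h : lam ∈ quasiPeriodic k n) (α : Fin k → ℤ)
    (j : Fin k) : window k (lam ∘ yPow k α) j = window k lam j + n * α j := by
  simp only [window, Function.comp, yPow_apply, quasiPeriodic_sub_mul h]

theorem tau_zpow_apply (d m : ℤ) : (tau ^ d) m = m - d := by
  induction d generalizing m with
  | zero => simp
  | succ d ih =>
    rw [zpow_add_one, Equiv.Perm.mul_apply, ih]
    simp only [tau, Equiv.subRight_apply]; ring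
  | pred d ih =>
    rw [zpow_sub_one, Equiv.Perm.mul_apply, ih]
    have : tau⁻¹ m = m + 1 := by rw [Equiv.Perm.inv_eq_iff_eq]; simp [tau]
    rw [this]; ring

theorem shiftLoop_eq (lam : ℤ → ℤ) (d : ℤ) : shiftLoop lam d = lam ∘ (tau ^ d) := by
  funext i
  simp [shiftLoop, tau_zpow_apply]

/-- Elements of the alcove are weakly decreasing on all of `ℤ`. -/
theorem alcove_antitone {k n : ℕ} (hk : 0 < k) {lam : ℤ → ℤ} (h : lam ∈ alcove k n) :
    Antitone lam := by
  obtain ⟨hp, h1, h2, h3⟩ := h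
  apply antitone_int_of_succ_le
  intro i
  have hk' : (0 : ℤ) < k := by exact_mod_cast hk
  have e1 := Int.emod_nonneg (i - 1) hk'.ne'
  have e2 := Int.emod_lt_of_pos (i - 1) hk'
  have e3 := Int.emod_add_mul_ediv (i - 1) k
  generalize (i - 1) % (k : ℤ) = r at *
  generalize (i - 1) / (k : ℤ) = q at *
  have ei : i = (r + 1) - k * (-q) := by linear_combination -e3
  have ej : i + 1 = (r + 1 + 1) - k * (-q) := by linear_combination -e3
  rw [ej, ei, quasiPeriodic_sub_mul hp, quasiPeriodic_sub_mul hp]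
  by_cases hr : r + 1 < k
  · have := h2 (r + 1) (by omega) hr
    omega
  · have hr' : r + 1 = k := by omega
    have := hp 1
    rw [hr', show (k : ℤ) + 1 = 1 + k by ring, this]
    omega

/-- The loop `λ[d]` with `λ` in the alcove has degree `d`. -/
theorem loopDegree_shiftLoop {k n : ℕ} (hk : 0 < k) {lam : ℤ → ℤ} (h : lam ∈ alcove k n) (d : ℤ) :
    loopDegree n (shiftLoop lam d) = d := by
  have ha := alcove_antitone hk h
  obtain ⟨hp, h1, h2, h3⟩ := h
  have h0 : (n : ℤ) < lam 0 := by
    have := hp 0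
    rw [zero_add] at this
    omega
  have : {a : ℤ | (n : ℤ) < shiftLoop lam d a} = Set.Iic d := by
    ext a
    simp only [shiftLoop, Set.mem_ofPred_eq, Set.mem_Iic]
    constructor
    · intro hlt
      by_contra hc
      have := ha (show (1 : ℤ) ≤ a - d by omega)
      omega
    · intro hle
      have := ha (show a - d ≤ 0 by omega)
      omega
  rw [loopDegree, this, csSup_Iic]

theorem loopBase_shiftLoop {k n : ℕ} (hk : 0 < k) {lam : ℤ → ℤ} (h : lam ∈ alcove k n) (d : ℤ) :
    loopBase n (shiftLoop lam d) = lam := by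
  funext i
  simp [loopBase, loopDegree_shiftLoop hk h, shiftLoop]

end CylSymm

end

noncomputable section

namespace CylSymm

/-! ### Conjugates of weights and the Pieri rule -/

/-! Every weight `p` in `ℤ^k` extends quasi-periodically to `ℤ`, and sorting the extension gives a
cylindric loop, `loopOf n p`. Two weights sort to the same loop exactly when their conjugates
`conjOf` agree. For a loop in the alcove, these weights form its orbit under permutations of the
coordinates and translations by `n β` with `∑ β = 0` (`conjOf_eq_iff`).

The core is a Pieri rule (`ncard_le_conjOf_eq`): for any `q` sorting to `L`, the number of `p ≤ q`
sorting to `M` is a difference of two products of binomial coefficients, namely the weight `χ` of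
the step from `M` to `L` (`chi_eq_ncard`). It depends on `q` only through `L`. Hence the product of
the weights along a reverse plane partition `π` counts the chains of weights that end in a fixed `q`
and sort, term by term, to the bounding loops of `π` (`card_weightChains`).

Fix `q = λ + n α` with `|α| = d`, which sorts to `λ[d]`. The successive differences of a chain are
the columns of a nonnegative integer matrix with `k` rows, and its column sums are the exponents of
`x^π`. Sorting is monotone, so conversely each such matrix arises from exactly one `π`. The
coefficient at `x^θ` is therefore the number of matrices with column sums `θ` whose row sums `x` are
such that `q - x` sorts to `μ` (`coeff_cylindricH`). Permuting columns proves symmetry. Matrices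
with given row sums `x` and column sums `θ` are counted by the coefficient of `h_x` at `x^θ`, so the
function is the sum of `h_x` over all admissible `x` (`ncard_orbitMatrices`). Collecting the `x`
with the same decreasing rearrangement `ν` gives the multiplicity of `h_ν`. Since minimal coset
representatives parametrise rearrangements, this multiplicity is `N` (`fusionN_eq`). -/

/-- The conjugate of the cylindric loop obtained by sorting the quasi-periodic extension of a
weight `p`. -/
def conjOf (n : ℕ) {k : ℕ} (p : Fin k → ℤ) (j : ℤ) : ℤ := ∑ i, ((p i - j) / n + 1)

/-- The product of binomial coefficients attached to a pair of conjugate loops. -/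
def pieriProd (n : ℕ) (c' c : ℤ → ℤ) : ℤ :=
  ∏ j ∈ Finset.Icc (1 : ℤ) n, binom (c' j - c (j + 1)) (c j - c (j + 1))

theorem binom_eq_zero_of_lt {a b : ℤ} (h : a < b) : binom a b = 0 := by
  unfold binom
  split_ifs with h'
  · rfl
  · rw [Nat.choose_eq_zero_of_lt (by omega)]; rfl

/-- The case `a = b = 0` must be excluded: there the left side is `1`, while both terms on the right
vanish by the convention for negative arguments. -/
theorem binom_pascal {a b : ℤ} (h : ¬ (a = 0 ∧ b = 0)) :
    binom a b = binom (a - 1) b + binom (a - 1) (b - 1) := by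
  rcases lt_or_ge a b with hab | hab
  · rw [binom_eq_zero_of_lt hab, binom_eq_zero_of_lt (by omega), binom_eq_zero_of_lt (by omega)]
    rfl
  · unfold binom
    by_cases hb : b < 0
    · rw [if_pos (by omega), if_pos (by omega), if_pos (by omega)]; rfl
    · obtain ⟨x, rfl⟩ : ∃ x : ℕ, a = x + 1 := ⟨(a - 1).toNat, by omega⟩
      lift b to ℕ using by omega
      rw [if_neg (by omega), if_neg (by omega)]
      rcases b with _ | b
      · simp
      · rw [if_neg (by omega)]
        have e1 : ((x : ℤ) + 1).toNat = x + 1 := by omega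
        have e2 : ((x : ℤ) + 1 - 1).toNat = x := by omega
        have e3 : (((b + 1 : ℕ) : ℤ) - 1).toNat = b := by omega
        rw [e1, e2, e3, Int.toNat_natCast, Nat.choose_succ_succ]
        push_cast; ring

theorem conjOf_add_period {n : ℕ} (hn : 0 < n) {k : ℕ} (p : Fin k → ℤ) (j : ℤ) :
    conjOf n p (j + n) = conjOf n p j - k := by
  have hn' : (n : ℤ) ≠ 0 := by omega
  have : ∀ i, (p i - (j + n)) / (n : ℤ) + 1 = ((p i - j) / n + 1) - 1 := fun i => by
    rw [show p i - (j + n) = p i - j + n * (-1) by ring, Int.add_mul_ediv_left _ _ hn']; ring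
  simp only [conjOf, this]
  rw [Finset.sum_sub_distrib]
  simp

theorem conjOf_cons (n : ℕ) {k : ℕ} (v : ℤ) (p : Fin k → ℤ) (j : ℤ) :
    conjOf n (Fin.cons v p : Fin (k + 1) → ℤ) j = ((v - j) / n + 1) + conjOf n p j := by
  simp [conjOf, Fin.sum_univ_succ]

theorem ediv_sub_ediv_sub_one {n : ℕ} (hn : 0 < n) (x : ℤ) :
    x / (n : ℤ) - (x - 1) / n = if (n : ℤ) ∣ x then 1 else 0 := by
  have hn' : (0 : ℤ) < n := by omega
  have e1 := Int.emod_nonneg x hn'.ne'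
  have e2 := Int.emod_lt_of_pos x hn'
  have e3 := Int.emod_add_mul_ediv x n
  have hd : (n : ℤ) ∣ x ↔ x % n = 0 := Int.dvd_iff_emod_eq_zero
  simp only [hd]
  set r := x % (n : ℤ)
  set t := x / (n : ℤ)
  have e4 : (x - 1) / (n : ℤ) = t + (r - 1) / n := by
    rw [← e3, show r + n * t - 1 = r - 1 + n * t by ring, Int.add_mul_ediv_left _ _ hn'.ne']; ring
  rw [e4]
  by_cases hr : r = 0
  · rw [if_pos hr, hr, show (0 : ℤ) - 1 = (n - 1) + n * (-1) by ring,
      Int.add_mul_ediv_left _ _ hn'.ne', Int.ediv_eq_zero_of_lt (by omega) (by omega)]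
    ring
  · rw [if_neg hr, Int.ediv_eq_zero_of_lt (by omega) (by omega)]
    ring

theorem conjOf_sub_succ {n : ℕ} (hn : 0 < n) {k : ℕ} (p : Fin k → ℤ) (j : ℤ) :
    conjOf n p j - conjOf n p (j + 1) = ∑ i, if (n : ℤ) ∣ p i - j then 1 else 0 := by
  rw [conjOf, conjOf, ← Finset.sum_sub_distrib]
  refine Finset.sum_congr rfl fun i _ => ?_
  rw [← ediv_sub_ediv_sub_one hn, show p i - (j + 1) = p i - j - 1 by ring]; ring

theorem ediv_natCast_mono (n : ℕ) {a b : ℤ} (h : a ≤ b) : a / (n : ℤ) ≤ b / n := by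
  rcases Nat.eq_zero_or_pos n with rfl | hn
  · simp
  · exact Int.ediv_le_ediv (by omega) h

theorem conjOf_mono (n : ℕ) {k : ℕ} {p q : Fin k → ℤ} (h : p ≤ q) :
    conjOf n p ≤ conjOf n q := fun j =>
  Finset.sum_le_sum fun i _ => by
    exact add_le_add_left (ediv_natCast_mono n (sub_le_sub_right (h i) j)) 1

theorem conjOf_antitone {n : ℕ} {k : ℕ} (p : Fin k → ℤ) : Antitone (conjOf n p) :=
  fun a b hab => Finset.sum_le_sum fun i _ => by
    exact add_le_add_left (ediv_natCast_mono n (sub_le_sub_left hab (p i))) 1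

/-- All terms vanish at `x = 0`, and raising `x` by one raises exactly one term by one, the term
whose `j` is congruent to the new `x`. Used with period `n` to recover `|p|` from its conjugate, and
with period `k` to compute the conjugate of a loop. -/
theorem sum_ediv_eq {n : ℕ} (hn : 0 < n) (x : ℤ) :
    ∑ j ∈ Finset.Icc (1 : ℤ) n, ((x - j) / n + 1) = x := by
  have step : ∀ x : ℤ, ∑ j ∈ Finset.Icc (1 : ℤ) n, ((x - j) / n + 1) -
      ∑ j ∈ Finset.Icc (1 : ℤ) n, ((x - 1 - j) / n + 1) = 1 := by
    intro x
    rw [← Finset.sum_sub_distrib]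
    have hn' : (0 : ℤ) < n := by omega
    have e1 := Int.emod_nonneg (x - 1) hn'.ne'
    have e2 := Int.emod_lt_of_pos (x - 1) hn'
    have e3 := Int.emod_add_mul_ediv (x - 1) n
    rw [Finset.sum_eq_single ((x - 1) % n + 1)]
    · have := ediv_sub_ediv_sub_one hn (x - ((x - 1) % n + 1))
      rw [if_pos ⟨(x - 1) / n, by linear_combination -e3⟩] at this
      rw [show x - 1 - ((x - 1) % (n : ℤ) + 1) = x - ((x - 1) % n + 1) - 1 by ring]
      linarith
    · intro j hj hne
      rw [Finset.mem_Icc] at hj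
      have := ediv_sub_ediv_sub_one hn (x - j)
      rw [if_neg] at this
      · rw [show x - 1 - j = x - j - 1 by ring]; linarith
      · intro hd
        apply hne
        have h2 : (n : ℤ) ∣ ((x - 1) % n + 1) - j := by
          have := dvd_sub hd (dvd_mul_right (n : ℤ) ((x - 1) / n))
          rwa [show x - j - n * ((x - 1) / n) = ((x - 1) % n + 1) - j by
            linear_combination -e3] at this
        have := Int.eq_zero_of_abs_lt_dvd h2 (by rw [abs_lt]; omega)
        omega
    · intro h
      exact absurd (Finset.mem_Icc.mpr ⟨by omega, by omega⟩) h
  induction x with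
  | zero =>
    have hn' : (0 : ℤ) < n := by omega
    refine Finset.sum_eq_zero fun j hj => ?_
    rw [Finset.mem_Icc] at hj
    rw [show (0 : ℤ) - j = (n - j) + n * (-1) by ring,
      Int.add_mul_ediv_left _ _ hn'.ne', Int.ediv_eq_zero_of_lt (by omega) (by omega)]
    ring
  | succ x ih =>
    have := step (x + 1)
    simp only [add_sub_cancel_right] at this
    linarith
  | pred x ih =>
    have := step (-x)
    linarith

theorem sum_conjOf {n : ℕ} (hn : 0 < n) {k : ℕ} (p : Fin k → ℤ) :
    ∑ j ∈ Finset.Icc (1 : ℤ) n, conjOf n p j = ∑ i, p i := by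
  simp only [conjOf]
  rw [Finset.sum_comm]
  exact Finset.sum_congr rfl fun i _ => sum_ediv_eq hn (p i)

theorem sum_eq_of_conjOf_eq {n : ℕ} (hn : 0 < n) {k : ℕ} {p q : Fin k → ℤ}
    (h : conjOf n p = conjOf n q) : ∑ i, p i = ∑ i, q i := by
  rw [← sum_conjOf hn, ← sum_conjOf hn, h]

theorem finite_le_sum_eq {k : ℕ} (q : Fin k → ℤ) (s : ℤ) :
    {p : Fin k → ℤ | p ≤ q ∧ ∑ i, p i = s}.Finite := by
  apply (Set.finite_Icc (fun i => q i - (∑ i, q i - s)) q).subset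
  rintro p ⟨hp, rfl⟩
  -- No single coordinate can fall short of `q` by more than the total deficit.
  refine ⟨fun i => ?_, hp⟩
  have : q i - p i ≤ ∑ i, (q i - p i) :=
    Finset.single_le_sum (f := fun i => q i - p i) (fun i _ => sub_nonneg.mpr (hp i))
      (Finset.mem_univ i)
  rw [Finset.sum_sub_distrib] at this
  simp only
  linarith

theorem finite_le_conjOf_eq {n : ℕ} (hn : 0 < n) {k : ℕ} (q : Fin k → ℤ) (c : ℤ → ℤ) :
    {p : Fin k → ℤ | p ≤ q ∧ conjOf n p = c}.Finite := by
  apply (finite_le_sum_eq q (∑ j ∈ Finset.Icc (1 : ℤ) n, c j)).subset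
  rintro p ⟨hp, rfl⟩
  exact ⟨hp, (sum_conjOf hn p).symm⟩

theorem pieriProd_eq_zero {n : ℕ} {c' c : ℤ → ℤ} {j : ℤ} (hj : j ∈ Finset.Icc (1 : ℤ) n)
    (h : c' j < c j) : pieriProd n c' c = 0 :=
  Finset.prod_eq_zero hj (binom_eq_zero_of_lt (by omega))

theorem exists_residue {n : ℕ} (hn : 0 < n) (v : ℤ) :
    ∃ j ∈ Finset.Icc (1 : ℤ) n, ∃ t, v = j + n * t := by
  have hn' : (0 : ℤ) < n := by omega
  have e1 := Int.emod_nonneg (v - 1) hn'.ne'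
  have e2 := Int.emod_lt_of_pos (v - 1) hn'
  have e3 := Int.emod_add_mul_ediv (v - 1) n
  exact ⟨(v - 1) % n + 1, Finset.mem_Icc.mpr ⟨by omega, by omega⟩, (v - 1) / n,
    by linear_combination -e3⟩

theorem dvd_sub_iff_eq {n : ℕ} {i j t : ℤ} (hi : i ∈ Finset.Icc (1 : ℤ) n)
    (hj : j ∈ Finset.Icc (1 : ℤ) n) : (n : ℤ) ∣ i + n * t - j ↔ j = i := by
  rw [Finset.mem_Icc] at hi hj
  constructor
  · intro h
    have h2 : (n : ℤ) ∣ i - j := by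
      have := dvd_sub h (dvd_mul_right (n : ℤ) t)
      rwa [show i + n * t - j - n * t = i - j by ring] at this
    have := Int.eq_zero_of_abs_lt_dvd h2 (by rw [abs_lt]; omega)
    omega
  · rintro rfl
    exact ⟨t, by ring⟩

/-- Pascal's rule applied to the single factor `i`. In the excluded case `A i = M i = 0` the
hypothesis supplies another factor that annihilates all three products. -/
theorem prod_pascal {s : Finset ℤ} {A M : ℤ → ℤ} {i : ℤ} (hi : i ∈ s)
    (h : A i = 0 → M i = 0 → ∃ j ∈ s, A j < M j) :
    ∏ j ∈ s, binom (A j) (M j) =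
      ∏ j ∈ s, binom (A j - if j = i then 1 else 0) (M j) +
      ∏ j ∈ s, binom (A j - if j = i then 1 else 0) (M j - if j = i then 1 else 0) := by
  by_cases h0 : A i = 0 ∧ M i = 0
  · obtain ⟨j, hj, hlt⟩ := h h0.1 h0.2
    have e0 : ∏ j ∈ s, binom (A j) (M j) = 0 :=
      Finset.prod_eq_zero hj (binom_eq_zero_of_lt hlt)
    have e1 : ∏ j ∈ s, binom (A j - if j = i then 1 else 0) (M j) = 0 :=
      Finset.prod_eq_zero hj (binom_eq_zero_of_lt (by split_ifs <;> omega))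
    have e2 : ∏ j ∈ s, binom (A j - if j = i then 1 else 0) (M j - if j = i then 1 else 0) = 0 :=
      Finset.prod_eq_zero hj (binom_eq_zero_of_lt (by omega))
    rw [e0, e1, e2]
    rfl
  · rw [← Finset.mul_prod_erase s _ hi, ← Finset.mul_prod_erase s _ hi,
      ← Finset.mul_prod_erase s _ hi, binom_pascal h0, add_mul]
    have e1 : ∏ x ∈ s.erase i, binom (A x) (M x) =
        ∏ x ∈ s.erase i, binom (A x - if x = i then 1 else 0) (M x) :=
      Finset.prod_congr rfl fun x hx => by simp [Finset.ne_of_mem_erase hx]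
    have e2 : ∏ x ∈ s.erase i, binom (A x) (M x) = ∏ x ∈ s.erase i,
        binom (A x - if x = i then 1 else 0) (M x - if x = i then 1 else 0) :=
      Finset.prod_congr rfl fun x hx => by simp [Finset.ne_of_mem_erase hx]
    rw [← e1, ← e2]
    simp

/-- The recursion behind the Pieri rule. Lowering the coordinate `v` by one lowers the conjugate
only at the residue of `v`, so Pascal's rule at that factor applies. Its two terms correspond to
weights whose first coordinate is at most `v - 1` and to weights whose first coordinate is `v`; in
the latter case the contribution of `v` is removed from `c`. -/
theorem pieriProd_cons {n : ℕ} (hn : 0 < n) {k : ℕ} (v : ℤ) (q : Fin k → ℤ) (c : ℤ → ℤ)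
    (hc : ∀ j, c (j + n) = c j - (k + 1)) :
    pieriProd n (conjOf n (Fin.cons v q : Fin (k + 1) → ℤ)) c =
      pieriProd n (conjOf n (Fin.cons (v - 1) q : Fin (k + 1) → ℤ)) c +
      pieriProd n (conjOf n q) (fun j => c j - ((v - j) / n + 1)) := by
  obtain ⟨i, hi, t, rfl⟩ := exists_residue hn v
  have hδ : ∀ j ∈ Finset.Icc (1 : ℤ) n, (i + n * t - j) / n - (i + n * t - j - 1) / (n : ℤ) =
      if j = i then 1 else 0 := fun j hj => by
    rw [ediv_sub_ediv_sub_one hn]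
    exact if_congr (dvd_sub_iff_eq hi hj) rfl rfl
  set c' := conjOf n (Fin.cons (i + n * t) q : Fin (k + 1) → ℤ) with hc'
  have key := prod_pascal (s := Finset.Icc (1 : ℤ) n) (A := fun j => c' j - c (j + 1))
    (M := fun j => c j - c (j + 1)) hi ?_
  · rw [pieriProd, key]
    congr 1
    · refine Finset.prod_congr rfl fun j hj => ?_
      congr 1
      rw [hc', conjOf_cons, conjOf_cons, ← hδ j hj,
        show i + n * t - 1 - j = i + n * t - j - 1 by ring]
      ring
    · refine Finset.prod_congr rfl fun j hj => ?_
      beta_reduce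
      rw [hc', conjOf_cons, ← hδ j hj, show i + n * t - (j + 1) = i + n * t - j - 1 by ring]
      congr 1 <;> ring
  · intro hA hM
    -- The coordinate `v` itself makes `c'` drop strictly from `i` to `i + 1`, whereas `hA` says `c'
    -- i = c (i + 1)`. So the factor at `i + 1` vanishes; for `i = n` it is moved back to `1` by
    -- periodicity.
    have hlt : c' (i + 1) < c (i + 1) := by
      have := conjOf_sub_succ hn (Fin.cons (i + n * t) q : Fin (k + 1) → ℤ) i
      rw [← hc', Fin.sum_univ_succ, Fin.cons_zero, if_pos ⟨t, by ring⟩] at this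
      have h0 : 0 ≤ ∑ x : Fin k, if (n : ℤ) ∣
          (Fin.cons (i + n * t) q : Fin (k + 1) → ℤ) x.succ - i then (1 : ℤ) else 0 :=
        Finset.sum_nonneg fun x _ => by split_ifs <;> norm_num
      omega
    rw [Finset.mem_Icc] at hi
    by_cases hin : i = n
    · refine ⟨1, Finset.mem_Icc.mpr ⟨le_rfl, by omega⟩, ?_⟩
      have h1 := hc 1
      have h2 := conjOf_add_period hn (Fin.cons (i + n * t) q : Fin (k + 1) → ℤ) 1
      rw [← hc'] at h2
      rw [add_comm, ← hin] at h1 h2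
      push_cast at h2
      omega
    · exact ⟨i + 1, Finset.mem_Icc.mpr ⟨by omega, by omega⟩, by omega⟩

/-- The Pieri rule: counting the weights below `q` in a given orbit. -/
theorem ncard_le_conjOf_eq {n : ℕ} (hn : 0 < n) {k : ℕ} (q : Fin k → ℤ) (c : ℤ → ℤ)
    (hc : ∀ j, c (j + n) = c j - k) :
    ({p : Fin k → ℤ | p ≤ q ∧ conjOf n p = c}.ncard : ℤ) =
      pieriProd n (conjOf n q) c - pieriProd n (conjOf n q) (fun j => c j + 1) := by
  have hone : (1 : ℤ) ∈ Finset.Icc (1 : ℤ) n := Finset.mem_Icc.mpr ⟨le_rfl, by omega⟩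
  -- Induction on the number of coordinates and, inside it, on the first coordinate of `q`. The
  -- subtracted product is needed because a single product counts the weights with conjugate `c + m`
  -- for all `m ≥ 0` together.
  induction k generalizing c with
  | zero =>
    have hz : ∀ p : Fin 0 → ℤ, conjOf n p = 0 := fun p => by funext j; simp [conjOf]
    by_cases h0 : c = 0
    · subst h0
      have : {p : Fin 0 → ℤ | p ≤ q ∧ conjOf n p = 0} = {q} := by
        ext p; simp [hz, Subsingleton.elim p q]
      rw [this, hz]
      rw [pieriProd_eq_zero (c' := 0) (c := fun j => (0 : ℤ → ℤ) j + 1) hone (by simp)]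
      simp [pieriProd, binom]
    · have : {p : Fin 0 → ℤ | p ≤ q ∧ conjOf n p = c} = ∅ := by
        ext p; simp [hz, Ne.symm h0]
      rw [this, hz, Set.ncard_empty]
      -- With no coordinates, `c` is `n`-periodic. Either it increases somewhere, and a negative
      -- lower argument kills both products, or it is a constant `c 0 ≠ 0`. Then the two products
      -- are both `0` if `c 0 > 0` and both `1` if `c 0 < 0`.
      by_cases hj : ∃ j ∈ Finset.Icc (1 : ℤ) n, c j < c (j + 1)
      · obtain ⟨j, hj, hlt⟩ := hj
        rw [pieriProd, pieriProd, Finset.prod_eq_zero hj, Finset.prod_eq_zero hj]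
        · rfl
        · exact if_pos (Or.inr (by omega))
        · exact if_pos (Or.inr (by omega))
      · push Not at hj
        have hq : c ∈ quasiPeriodic n 0 := fun i => by simpa using hc i
        have hper : ∀ i t : ℤ, c (i + n * t) = c i := fun i t => by
          have := quasiPeriodic_sub_mul hq i (-t)
          simpa using this
        have hanti : Antitone c := by
          apply antitone_int_of_succ_le
          intro v
          obtain ⟨i, hi, t, rfl⟩ := exists_residue hn v
          rw [add_right_comm, hper, hper]
          exact hj i hi
        have hconst : ∀ j, c j = c 0 := fun j => by
          have h1 := hanti (show j ≤ 0 + n * |j| by nlinarith [le_abs_self j, abs_nonneg j])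
          have h2 := hanti (show 0 + n * (-|j|) ≤ j by nlinarith [neg_abs_le j, abs_nonneg j])
          rw [hper] at h1 h2
          omega
        have hne : c 0 ≠ 0 := fun h => h0 (funext fun j => by rw [hconst, h]; rfl)
        simp only [pieriProd, hconst, binom]
        by_cases hneg : c 0 < 0
        · simp [show ¬ 0 < c 0 by omega, show ¬ -1 < c 0 by omega]
        · simp [show 0 < c 0 by omega, show -1 < c 0 by omega]
  | succ k ih =>
    rw [← Fin.cons_self_tail q]
    generalize q 0 = v
    generalize Fin.tail q = q
    -- For `v` this small the conjugate of `q` at `1` is below `c 1`, so there are no weights to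
    -- count and both products vanish.
    have hbase : ∀ v, v ≤ n * (c 1 - conjOf n q 1 - 1) →
      ({p : Fin (k + 1) → ℤ | p ≤ Fin.cons v q ∧ conjOf n p = c}.ncard : ℤ) =
      pieriProd n (conjOf n (Fin.cons v q : Fin (k + 1) → ℤ)) c -
        pieriProd n (conjOf n (Fin.cons v q : Fin (k + 1) → ℤ)) (fun j => c j + 1) := by
      intro v hv
      have hlt : conjOf n (Fin.cons v q : Fin (k + 1) → ℤ) 1 < c 1 := by
        rw [conjOf_cons]
        have : (v - 1) / n < (c 1 - conjOf n q 1 - 1) :=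
          Int.ediv_lt_of_lt_mul (by omega) (by linarith)
        omega
      rw [pieriProd_eq_zero hone hlt, pieriProd_eq_zero hone (by omega)]
      have : {p : Fin (k + 1) → ℤ | p ≤ Fin.cons v q ∧ conjOf n p = c} = ∅ := by
        rw [Set.eq_empty_iff_forall_notMem]
        rintro p ⟨hp, rfl⟩
        exact absurd (conjOf_mono n hp 1) (not_le.mpr hlt)
      simp [this]
    rcases le_total v (n * (c 1 - conjOf n q 1 - 1)) with hv | hv
    · exact hbase v hv
    · induction v, hv using Int.leInduction with
      | base => exact hbase _ le_rfl
      | succ v _ ihv =>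
        have e1 := pieriProd_cons hn (v + 1) q c (by exact_mod_cast hc)
        have e2 := pieriProd_cons hn (v + 1) q (fun j => c j + 1)
          (fun j => by have := hc j; push_cast at this; linarith)
        rw [add_sub_cancel_right] at e1 e2
        have e3 := ih q (fun j => c j - ((v + 1 - j) / n + 1)) (fun j => by
          have := hc j
          rw [this, show v + 1 - (j + n) = v + 1 - j + n * (-1) by ring,
            Int.add_mul_ediv_left _ _ (by omega)]
          push_cast; ring)
        -- Split according to whether the first coordinate attains the new bound `v + 1`.
        have hset : {p : Fin (k + 1) → ℤ | p ≤ Fin.cons (v + 1) q ∧ conjOf n p = c} =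
            {p : Fin (k + 1) → ℤ | p ≤ Fin.cons v q ∧ conjOf n p = c} ∪
            (fun p : Fin k → ℤ => (Fin.cons (v + 1) p : Fin (k + 1) → ℤ)) ''
              {p | p ≤ q ∧ conjOf n p = fun j => c j - ((v + 1 - j) / n + 1)} := by
          ext p
          rw [← Fin.cons_self_tail p]
          generalize p 0 = u
          generalize Fin.tail p = p
          simp only [Set.mem_union, Set.mem_image, Set.mem_ofPred_eq, Fin.cons_le_cons, Fin.cons_inj]
          constructor
          · rintro ⟨⟨hu, hp⟩, rfl⟩
            rcases eq_or_lt_of_le hu with rfl | hu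
            · exact Or.inr ⟨p, ⟨hp, funext fun j => by rw [conjOf_cons]; ring⟩, rfl, rfl⟩
            · exact Or.inl ⟨⟨by omega, hp⟩, rfl⟩
          · rintro (⟨⟨hu, hp⟩, rfl⟩ | ⟨p, ⟨hp, he⟩, rfl, rfl⟩)
            · exact ⟨⟨by omega, hp⟩, rfl⟩
            · exact ⟨⟨le_rfl, hp⟩, funext fun j => by rw [conjOf_cons, he]; ring⟩
        rw [hset, Set.ncard_union_eq ?_ (finite_le_conjOf_eq hn _ _)
          ((finite_le_conjOf_eq hn _ _).image _),
          Set.ncard_image_of_injective _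
            (f := fun p : Fin k → ℤ => (Fin.cons (v + 1) p : Fin (k + 1) → ℤ))
            fun a b h => (Fin.cons_inj.mp h).2]
        · push_cast
          rw [ihv, e3, e1, e2]
          have : (fun j => c j - ((v + 1 - j) / (n : ℤ) + 1) + 1) =
            fun j => c j + 1 - ((v + 1 - j) / n + 1) := by funext j; ring
          rw [this]
          ring
        · rw [Set.disjoint_left]
          rintro _ ⟨h1, -⟩ ⟨p, -, rfl⟩
          have := h1 0
          beta_reduce at this
          rw [Fin.cons_zero, Fin.cons_zero] at this
          omega

/-! ### Cylindric loops and their conjugates -/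

theorem bddAbove_setOf_le {k n : ℕ} (hn : 0 < n) {L : ℤ → ℤ}
    (hL : L ∈ quasiPeriodic k n) (ha : Antitone L) (j : ℤ) : BddAbove {a | j ≤ L a} := by
  -- After `|L 0| + |j| + 1` periods, each lowering `L` by `n ≥ 1`, the value has fallen below `j`.
  refine ⟨k * (|L 0| + |j| + 1), fun a hj => ?_⟩
  by_contra hc
  have h1 := ha (not_le.mp hc).le
  have h2 := quasiPeriodic_sub_mul hL 0 (-(|L 0| + |j| + 1))
  rw [show (0 : ℤ) - k * -(|L 0| + |j| + 1) = k * (|L 0| + |j| + 1) by ring] at h2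
  have h3 : j ≤ L a := hj
  have hn' : (1 : ℤ) ≤ n := by omega
  nlinarith [le_abs_self (L 0), neg_abs_le j, abs_nonneg j, abs_nonneg (L 0)]

theorem nonempty_setOf_le {k n : ℕ} (hn : 0 < n) {L : ℤ → ℤ}
    (hL : L ∈ quasiPeriodic k n) (j : ℤ) : {a | j ≤ L a}.Nonempty := by
  refine ⟨0 - k * (|L 0| + |j|), ?_⟩
  have hn' : (1 : ℤ) ≤ n := by omega
  rw [Set.mem_ofPred_eq, quasiPeriodic_sub_mul hL]
  nlinarith [le_abs_self j, neg_abs_le (L 0), abs_nonneg j, abs_nonneg (L 0)]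

/-- The Galois connection from which the properties of conjugation follow. The supremum in
`conjLoop` is attained because the set is nonempty and bounded above. -/
theorem le_conjLoop_iff {k n : ℕ} (hn : 0 < n) {L : ℤ → ℤ}
    (hL : L ∈ quasiPeriodic k n) (ha : Antitone L) {a j : ℤ} :
    a ≤ conjLoop L j ↔ j ≤ L a := by
  have hb := bddAbove_setOf_le hn hL ha j
  constructor
  · intro h
    have hm : j ≤ L (conjLoop L j) := Int.csSup_mem (nonempty_setOf_le hn hL j) hb
    exact hm.trans (ha h)
  · exact fun h => le_csSup hb h

theorem conjLoop_mem_quasiPeriodic {k n : ℕ} (hn : 0 < n) {L : ℤ → ℤ}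
    (hL : L ∈ quasiPeriodic k n) (ha : Antitone L) : conjLoop L ∈ quasiPeriodic n k := by
  intro j
  refine eq_of_forall_le_iff fun a => ?_
  have := hL a
  rw [le_conjLoop_iff hn hL ha, le_sub_iff_add_le, le_conjLoop_iff hn hL ha, this]
  omega

theorem conjLoop_antitone {k n : ℕ} (hn : 0 < n) {L : ℤ → ℤ}
    (hL : L ∈ quasiPeriodic k n) (ha : Antitone L) : Antitone (conjLoop L) := by
  intro i j hij
  rw [le_conjLoop_iff hn hL ha]
  exact hij.trans ((le_conjLoop_iff hn hL ha).mp le_rfl)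

theorem conjLoop_conjLoop {k n : ℕ} (hk : 0 < k) (hn : 0 < n) {L : ℤ → ℤ}
    (hL : L ∈ quasiPeriodic k n) (ha : Antitone L) : conjLoop (conjLoop L) = L := by
  funext a
  refine eq_of_forall_le_iff fun j => ?_
  rw [le_conjLoop_iff hk (conjLoop_mem_quasiPeriodic hn hL ha) (conjLoop_antitone hn hL ha),
    le_conjLoop_iff hn hL ha]

theorem conjLoop_le_conjLoop {k n : ℕ} (hn : 0 < n) {L M : ℤ → ℤ}
    (hL : L ∈ quasiPeriodic k n) (ha : Antitone L) (hM : M ∈ quasiPeriodic k n) (hb : Antitone M)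
    (h : M ≤ L) : conjLoop M ≤ conjLoop L := fun j => by
  rw [le_conjLoop_iff hn hL ha]
  exact ((le_conjLoop_iff hn hM hb).mp le_rfl).trans (h _)

theorem shiftLoop_mem_quasiPeriodic {k n : ℕ} {L : ℤ → ℤ} (hL : L ∈ quasiPeriodic k n) (e : ℤ) :
    shiftLoop L e ∈ quasiPeriodic k n := fun i => by
  have := hL (i - e)
  rw [sub_add_eq_add_sub] at this
  exact this

theorem shiftLoop_antitone {L : ℤ → ℤ} (ha : Antitone L) (e : ℤ) : Antitone (shiftLoop L e) :=
  fun _ _ h => ha (sub_le_sub_right h e)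

theorem conjLoop_shiftLoop {k n : ℕ} (hn : 0 < n) {L : ℤ → ℤ}
    (hL : L ∈ quasiPeriodic k n) (ha : Antitone L) (e j : ℤ) :
    conjLoop (shiftLoop L e) j = conjLoop L j + e := by
  refine eq_of_forall_le_iff fun a => ?_
  rw [le_conjLoop_iff hn (shiftLoop_mem_quasiPeriodic hL e) (shiftLoop_antitone ha e),
    ← sub_le_iff_le_add, le_conjLoop_iff hn hL ha]
  rfl

theorem sum_fin_add_one {M : Type*} [AddCommMonoid M] (k : ℕ) (f : ℤ → M) :
    ∑ i : Fin k, f ((i : ℤ) + 1) = ∑ j ∈ Finset.Icc (1 : ℤ) k, f j := by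
  refine Finset.sum_bij (fun i _ => (i : ℤ) + 1) (fun i _ => ?_) (fun i _ j _ h => ?_)
    (fun j hj => ?_) (fun _ _ => rfl)
  · have := i.2
    exact Finset.mem_Icc.mpr ⟨by omega, by omega⟩
  · exact Fin.ext (by omega)
  · rw [Finset.mem_Icc] at hj
    exact ⟨⟨(j - 1).toNat, by omega⟩, Finset.mem_univ _, by simp only; omega⟩

/-- The Galois connection gives `(L i - j) / n = (L'_j - i) / k` with rounding down, and summing the
right side over a period returns `L'_j`. -/
theorem conjLoop_eq_conjOf {k n : ℕ} (hk : 0 < k) (hn : 0 < n) {L : ℤ → ℤ}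
    (hL : L ∈ quasiPeriodic k n) (ha : Antitone L) : conjLoop L = conjOf n (window k L) := by
  funext j
  have key : ∀ i : ℤ, (L i - j) / n = (conjLoop L j - i) / k := fun i => by
    refine eq_of_forall_le_iff fun t => ?_
    have h := quasiPeriodic_sub_mul hL i (-t)
    rw [Int.le_ediv_iff_mul_le (by omega), Int.le_ediv_iff_mul_le (by omega),
      le_sub_iff_add_le, le_sub_iff_add_le, le_conjLoop_iff hn hL ha,
      show t * (k : ℤ) + i = i - k * -t by ring, h]
    constructor <;> intro _ <;> linarith
  rw [conjOf]
  simp only [window, key]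
  rw [sum_fin_add_one k (fun i => (conjLoop L j - i) / (k : ℤ) + 1), sum_ediv_eq hk]

/-- Shifting a loop adds a constant to its conjugate, and the binomials see only differences of
conjugates. So the normalisation to the alcove cancels, and `d - 1` in place of `d` amounts to
adding `1` to the conjugate of `M`. -/
theorem chi_eq {k n : ℕ} (hn : 0 < n) {L M : ℤ → ℤ}
    (hL : L ∈ quasiPeriodic k n) (ha : Antitone L) (hM : M ∈ quasiPeriodic k n) (hb : Antitone M) :
    chi n (loopBase n L) (loopDegree n L - loopDegree n M) (loopBase n M) =
      pieriProd n (conjLoop L) (conjLoop M) -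
        pieriProd n (conjLoop L) (fun j => conjLoop M j + 1) := by
  have hs : ∀ a, shiftLoop (loopBase n L) a = shiftLoop L (a - loopDegree n L) := fun a => by
    funext i
    simp only [loopBase, shiftLoop]
    congr 1; ring
  have hc : ∀ b j, conjLoop (loopBase n M) j = conjLoop M j - b ↔ b = loopDegree n M := by
    intro b j
    rw [loopBase, conjLoop_shiftLoop hn hM hb]
    omega
  have hc := fun j => (hc _ j).mpr rfl
  simp only [chi, chiProd, pieriProd, hs, hc, conjLoop_shiftLoop hn hL ha]
  congr 1 <;> refine Finset.prod_congr rfl fun j _ => ?_ <;> congr 1 <;> ring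

/-! ### Sorting a weight to a loop -/

/-- The cylindric loop obtained by sorting the quasi-periodic extension of a weight. -/
def loopOf (n : ℕ) {k : ℕ} (p : Fin k → ℤ) : ℤ → ℤ := conjLoop (conjOf n p)

theorem conjOf_mem_quasiPeriodic {n : ℕ} (hn : 0 < n) {k : ℕ} (p : Fin k → ℤ) :
    conjOf n p ∈ quasiPeriodic n k := conjOf_add_period hn p

theorem loopOf_mem_quasiPeriodic {k n : ℕ} (hk : 0 < k) (hn : 0 < n) (p : Fin k → ℤ) :
    loopOf n p ∈ quasiPeriodic k n :=
  conjLoop_mem_quasiPeriodic hk (conjOf_mem_quasiPeriodic hn p) (conjOf_antitone p)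

theorem loopOf_antitone {k n : ℕ} (hk : 0 < k) (hn : 0 < n) (p : Fin k → ℤ) :
    Antitone (loopOf n p) :=
  conjLoop_antitone hk (conjOf_mem_quasiPeriodic hn p) (conjOf_antitone p)

theorem conjLoop_loopOf {k n : ℕ} (hk : 0 < k) (hn : 0 < n) (p : Fin k → ℤ) :
    conjLoop (loopOf n p) = conjOf n p :=
  conjLoop_conjLoop hn hk (conjOf_mem_quasiPeriodic hn p) (conjOf_antitone p)

theorem loopOf_mono {k n : ℕ} (hk : 0 < k) (hn : 0 < n) {p q : Fin k → ℤ} (h : p ≤ q) :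
    loopOf n p ≤ loopOf n q :=
  conjLoop_le_conjLoop hk (conjOf_mem_quasiPeriodic hn q) (conjOf_antitone q)
    (conjOf_mem_quasiPeriodic hn p) (conjOf_antitone p) (conjOf_mono n h)

theorem loopOf_eq_iff {k n : ℕ} (hk : 0 < k) (hn : 0 < n) {L : ℤ → ℤ}
    (hL : L ∈ quasiPeriodic k n) (ha : Antitone L) (p : Fin k → ℤ) :
    loopOf n p = L ↔ conjOf n p = conjLoop L := by
  constructor
  · rintro rfl
    rw [conjLoop_loopOf hk hn]
  · intro h
    rw [loopOf, h, conjLoop_conjLoop hk hn hL ha]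

theorem sum_window_loopOf {k n : ℕ} (hk : 0 < k) (hn : 0 < n) (p : Fin k → ℤ) :
    ∑ i, window k (loopOf n p) i = ∑ i, p i := by
  apply sum_eq_of_conjOf_eq hn
  rw [← conjLoop_eq_conjOf hk hn (loopOf_mem_quasiPeriodic hk hn p) (loopOf_antitone hk hn p),
    conjLoop_loopOf hk hn]

/-- The weight of a cylindric step counts the weights below a given one. -/
theorem chi_eq_ncard {k n : ℕ} (hk : 0 < k) (hn : 0 < n) {L M : ℤ → ℤ}
    (hL : L ∈ quasiPeriodic k n) (ha : Antitone L) (hM : M ∈ quasiPeriodic k n) (hb : Antitone M)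
    {q : Fin k → ℤ} (hq : loopOf n q = L) :
    chi n (loopBase n L) (loopDegree n L - loopDegree n M) (loopBase n M) =
      {p : Fin k → ℤ | p ≤ q ∧ loopOf n p = M}.ncard := by
  simp only [loopOf_eq_iff hk hn hM hb]
  rw [ncard_le_conjOf_eq hn q _ (conjLoop_mem_quasiPeriodic hn hM hb), chi_eq hn hL ha hM hb,
    ← hq, conjLoop_loopOf hk hn]

/-! ### Reverse plane partitions and their bounding loops -/

theorem eq_of_le_of_sum_window_eq {k n : ℕ} (hk : 0 < k) (hn : 0 < n) {L M : ℤ → ℤ}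
    (hL : L ∈ quasiPeriodic k n) (ha : Antitone L) (hM : M ∈ quasiPeriodic k n) (hb : Antitone M)
    (hle : M ≤ L) (hs : ∑ i, window k M i = ∑ i, window k L i) : M = L := by
  have h : window k M = window k L := funext fun i =>
    (Finset.sum_eq_sum_iff_of_le (f := window k M) (g := window k L)
      fun i _ => hle ((i : ℤ) + 1)).mp hs i (Finset.mem_univ i)
  rw [← conjLoop_conjLoop hk hn hM hb, ← conjLoop_conjLoop hk hn hL ha,
    conjLoop_eq_conjOf hk hn hM hb, conjLoop_eq_conjOf hk hn hL ha, h]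

theorem eq_Ioc_of_pred_mem {S : Set ℤ} {m M : ℤ} (hS : S ⊆ Set.Ioc m M)
    (h : ∀ b, b + 1 ∈ S → m < b → b ∈ S) : S = Set.Ioc m (m + S.ncard) := by
  have key : ∃ x, m ≤ x ∧ S = Set.Ioc m x := by
    rcases S.eq_empty_or_nonempty with rfl | hne
    · exact ⟨m, le_rfl, by simp⟩
    · have hbdd : BddAbove S := ⟨M, fun b hb => (hS hb).2⟩
      have hx : sSup S ∈ S := Int.csSup_mem hne hbdd
      refine ⟨sSup S, (hS hx).1.le, Set.Subset.antisymm
        (fun b hb => ⟨(hS hb).1, le_csSup hbdd hb⟩) ?_⟩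
      have hdown : ∀ t : ℕ, m < sSup S - t → sSup S - t ∈ S := by
        intro t
        induction t with
        | zero => intro _; simpa using hx
        | succ t ih =>
          intro ht
          refine h _ ?_ ht
          rw [show sSup S - ((t + 1 : ℕ) : ℤ) + 1 = sSup S - t by push_cast; ring]
          exact ih (by push_cast at ht; omega)
      rintro b ⟨hb1, hb2⟩
      have := hdown (sSup S - b).toNat
      rw [show sSup S - ((sSup S - b).toNat : ℤ) = b by omega] at this
      exact this hb1
  obtain ⟨x, hx, rfl⟩ := key
  have : ((Set.Ioc m x).ncard : ℤ) = x - m := by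
    rw [← Finset.coe_Ioc, Set.ncard_coe_finset, Int.card_Ioc]; omega
  rw [this]
  congr 1; ring

namespace CylRPP

variable {k n : ℕ} {lam : ℤ → ℤ} {d : ℤ} {mu : ℤ → ℤ}

/-- Rows increase weakly, so the squares with entry `< i` fill an initial segment of the row;
counting them locates its end. -/
theorem setOf_entry_lt_eq_Ioc (π : CylRPP k n lam d mu) (i : ℕ) (a : ℤ) :
    {b : ℤ | ∃ h : (a, b) ∈ cylDiagram lam d mu, π.entry ⟨(a, b), h⟩ < i} =
      Set.Ioc (mu a) (π.level i a) := by
  refine eq_Ioc_of_pred_mem (M := shiftLoop lam d a) (fun b hb => hb.1) ?_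
  rintro b ⟨hb, hlt⟩ hm
  have hb' : (a, b) ∈ cylDiagram lam d mu := ⟨hm, le_trans (by simp) hb.2⟩
  exact ⟨hb', (π.along_row ⟨(a, b), hb'⟩ ⟨(a, b + 1), hb⟩ rfl).trans_lt hlt⟩

theorem entry_lt_iff (π : CylRPP k n lam d mu) (i : ℕ) (p : cylDiagram lam d mu) :
    π.entry p < i ↔ p.1.2 ≤ π.level i p.1.1 := by
  have := Set.ext_iff.mp (π.setOf_entry_lt_eq_Ioc i p.1.1) p.1.2
  simp only [Set.mem_ofPred_eq, Set.mem_Ioc] at this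
  constructor
  · exact fun h => (this.mp ⟨p.2, h⟩).2
  · exact fun h => (this.mpr ⟨p.2.1, h⟩).2

theorem le_level (π : CylRPP k n lam d mu) (i : ℕ) (a : ℤ) : mu a ≤ π.level i a := by
  simp only [level]; omega

theorem level_le (π : CylRPP k n lam d mu) (i : ℕ) (a : ℤ) :
    π.level i a ≤ shiftLoop lam d a := by
  by_contra hc
  have h1 := π.isShape a
  have h2 : π.level i a ∈ Set.Ioc (mu a) (π.level i a) := ⟨by omega, le_rfl⟩
  rw [← setOf_entry_lt_eq_Ioc] at h2
  exact hc h2.1.2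

theorem level_zero (π : CylRPP k n lam d mu) : π.level 0 = mu := by
  funext a
  simp [level]

theorem level_mono (π : CylRPP k n lam d mu) : Monotone π.level := fun i j hij a => by
  by_contra hc
  replace hc : ¬ π.level i a ≤ π.level j a := hc
  have h1 := π.le_level j a
  have h2 : π.level i a ∈ Set.Ioc (mu a) (π.level i a) := ⟨by omega, le_rfl⟩
  rw [← setOf_entry_lt_eq_Ioc] at h2
  obtain ⟨h, hlt⟩ := h2
  exact hc ((π.entry_lt_iff j _).mp (hlt.trans_le hij))

theorem level_mem_quasiPeriodic (π : CylRPP k n lam d mu) (hlam : lam ∈ quasiPeriodic k n)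
    (hmu : mu ∈ quasiPeriodic k n) (i : ℕ) : π.level i ∈ quasiPeriodic k n := by
  intro a
  have e1 := hmu a
  have e2 := shiftLoop_mem_quasiPeriodic hlam d a
  have hset : {b : ℤ | ∃ h : (a + k, b) ∈ cylDiagram lam d mu, π.entry ⟨(a + k, b), h⟩ < i} =
      (fun b => b - (n : ℤ)) ''
        {b : ℤ | ∃ h : (a, b) ∈ cylDiagram lam d mu, π.entry ⟨(a, b), h⟩ < i} := by
    have hd : ∀ b : ℤ, (a + k, b - n) ∈ cylDiagram lam d mu ↔ (a, b) ∈ cylDiagram lam d mu := by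
      intro b
      simp only [cylDiagram, Set.mem_ofPred_eq, e1, e2]
      omega
    ext b
    constructor
    · rintro ⟨h, hlt⟩
      have h' : (a, b + n) ∈ cylDiagram lam d mu := (hd _).mp (by simpa using h)
      refine ⟨b + n, ⟨h', ?_⟩, by simp⟩
      rwa [π.periodic ⟨(a, b + n), h'⟩ ⟨(a + k, b), h⟩ (by simp)]
    · rintro ⟨b, ⟨h, hlt⟩, rfl⟩
      refine ⟨(hd _).mpr h, ?_⟩
      rwa [← π.periodic ⟨(a, b), h⟩ ⟨(a + k, b - n), (hd _).mpr h⟩ rfl]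
  simp only [level]
  rw [hset, Set.ncard_image_of_injective _ (sub_left_injective), e1]
  ring

theorem level_antitone (π : CylRPP k n lam d mu) (hlam : Antitone lam) (hmu : Antitone mu)
    (i : ℕ) : Antitone (π.level i) := by
  apply antitone_int_of_succ_le
  intro a
  have h1 := π.le_level i a
  have h2 : mu (a + 1) ≤ mu a := hmu (by omega)
  by_cases hb : π.level i (a + 1) ≤ mu a
  · omega
  · have h3 : π.level i (a + 1) ∈ Set.Ioc (mu (a + 1)) (π.level i (a + 1)) := ⟨by omega, le_rfl⟩
    rw [← setOf_entry_lt_eq_Ioc] at h3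
    obtain ⟨h, hlt⟩ := h3
    have h' : (a, π.level i (a + 1)) ∈ cylDiagram lam d mu :=
      ⟨by simp only; omega, h.2.trans (shiftLoop_antitone hlam d (show a ≤ a + 1 by omega))⟩
    exact (π.entry_lt_iff i ⟨_, h'⟩).mp ((π.down_column ⟨_, h'⟩ ⟨_, h⟩ rfl).trans_lt hlt)

theorem weight_eq (π : CylRPP k n lam d mu) (i : ℕ) :
    (π.weight i : ℤ) = ∑ j, window k (π.level (i + 1)) j - ∑ j, window k (π.level i) j := by
  have hset : Subtype.val '' {p : cylDiagram lam d mu | 1 ≤ p.1.1 ∧ p.1.1 ≤ k ∧ π.entry p = i} =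
      (((Finset.Icc (1 : ℤ) k).sigma fun a => Finset.Ioc (π.level i a) (π.level (i + 1) a)).map
        (Equiv.sigmaEquivProd ℤ ℤ).toEmbedding : Set (ℤ × ℤ)) := by
    ext ⟨a, b⟩
    simp only [Set.mem_image, Subtype.exists, Finset.coe_map, Finset.mem_coe, Finset.mem_sigma,
      Finset.mem_Icc, Finset.mem_Ioc, Sigma.exists, Set.mem_ofPred_eq, Equiv.coe_toEmbedding,
      Equiv.sigmaEquivProd_apply]
    constructor
    · rintro ⟨p, hp, ⟨h1, h2, h3⟩, rfl⟩
      have e1 := π.entry_lt_iff i ⟨_, hp⟩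
      have e2 := π.entry_lt_iff (i + 1) ⟨_, hp⟩
      simp only at e1 e2 h1 h2
      exact ⟨a, b, ⟨⟨h1, h2⟩, by omega, by omega⟩, rfl⟩
    · rintro ⟨a, b, ⟨⟨h1, h2⟩, h3, h4⟩, h5⟩
      have e0 := π.le_level i a
      have hb : b ∈ Set.Ioc (mu a) (π.level (i + 1) a) := ⟨by omega, h4⟩
      rw [← setOf_entry_lt_eq_Ioc] at hb
      obtain ⟨hp, hlt⟩ := hb
      have e1 := π.entry_lt_iff i ⟨_, hp⟩
      simp only at e1
      exact ⟨(a, b), hp, ⟨h1, h2, by omega⟩, h5⟩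
  rw [weight, ← Set.ncard_image_of_injective _ Subtype.val_injective, hset, Set.ncard_coe_finset,
    Finset.card_map, Finset.card_sigma]
  push_cast
  simp only [window, sum_fin_add_one k (π.level i), sum_fin_add_one k (π.level (i + 1))]
  rw [← Finset.sum_sub_distrib]
  refine Finset.sum_congr rfl fun a _ => ?_
  have : π.level i a ≤ π.level (i + 1) a := π.level_mono (Nat.le_succ i) a
  rw [Int.card_Ioc]
  omega

/-- A square with entry `e ≥ N` separates the levels `e` and `e + 1`; but vanishing weight at `e`
gives these nested loops equal sums, hence makes them equal. -/
theorem level_eq_of_weight_eq_zero (hk : 0 < k) (hn : 0 < n) (hl : lam ∈ quasiPeriodic k n)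
    (hla : Antitone lam) (hm : mu ∈ quasiPeriodic k n) (hma : Antitone mu)
    (π : CylRPP k n lam d mu) {N : ℕ} (hN : ∀ i, N ≤ i → π.weight i = 0) :
    π.level N = shiftLoop lam d := by
  have hlt : ∀ p, π.entry p < N := by
    intro p
    by_contra hc
    have h0 := π.weight_eq (π.entry p)
    rw [hN _ (not_lt.mp hc)] at h0
    have he := eq_of_le_of_sum_window_eq hk hn
      (π.level_mem_quasiPeriodic hl hm (π.entry p + 1)) (π.level_antitone hla hma _)
      (π.level_mem_quasiPeriodic hl hm (π.entry p)) (π.level_antitone hla hma _)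
      (π.level_mono (Nat.le_succ _)) (by push_cast at h0; linarith)
    have h1 := π.entry_lt_iff (π.entry p) p
    rw [he, ← π.entry_lt_iff] at h1
    omega
  refine le_antisymm (fun a => π.level_le N a) fun a => ?_
  by_cases h : mu a < shiftLoop lam d a
  · exact (π.entry_lt_iff N ⟨(a, shiftLoop lam d a), h, le_rfl⟩).mp (hlt _)
  · exact (not_lt.mp h).trans (π.le_level N a)

theorem ext_level {π ρ : CylRPP k n lam d mu} (h : π.level = ρ.level) : π = ρ := by
  have : π.entry = ρ.entry := funext fun p =>
    eq_of_forall_gt_iff fun i => by rw [entry_lt_iff, entry_lt_iff, h]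
  cases π; cases ρ
  simp only at this
  subst this
  rfl

/-- The reverse plane partition with given bounding loops. -/
def ofLoops (L : ℕ → ℤ → ℤ) (N : ℕ) (hper : ∀ i, L i ∈ quasiPeriodic k n)
    (hanti : ∀ i, Antitone (L i)) (hmono : Monotone L) (h0 : L 0 = mu)
    (hN : L N = shiftLoop lam d) : CylRPP k n lam d mu where
  -- The set contains `N`, because the square lies below `L N ≤ L (N + 1)`; so this is an attained
  -- minimum and not the default value of `sInf`.
  entry p := sInf {i | p.1.2 ≤ L (i + 1) p.1.1}
  isShape i := by rw [← h0, ← hN]; exact hmono (Nat.zero_le N) i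
  periodic p q h := by
    congr 1
    ext i
    have := hper (i + 1) p.1.1
    simp only [Set.mem_ofPred_eq, h, this]
    omega
  down_column p q h := by
    apply Nat.sInf_le
    have hq : q.1.2 ≤ L (sInf {i | q.1.2 ≤ L (i + 1) q.1.1} + 1) q.1.1 :=
      Nat.sInf_mem (s := {i | q.1.2 ≤ L (i + 1) q.1.1})
        ⟨N, q.2.2.trans (hN ▸ hmono (Nat.le_succ N) q.1.1)⟩
    have h1 : q.1.1 = p.1.1 + 1 := by rw [h]
    have h2 : q.1.2 = p.1.2 := by rw [h]
    rw [Set.mem_ofPred_eq, ← h2]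
    exact hq.trans (hanti _ (by omega))
  along_row p q h := by
    apply Nat.sInf_le
    have hq : q.1.2 ≤ L (sInf {i | q.1.2 ≤ L (i + 1) q.1.1} + 1) q.1.1 :=
      Nat.sInf_mem (s := {i | q.1.2 ≤ L (i + 1) q.1.1})
        ⟨N, q.2.2.trans (hN ▸ hmono (Nat.le_succ N) q.1.1)⟩
    have h1 : q.1.1 = p.1.1 := by rw [h]
    have h2 : q.1.2 = p.1.2 + 1 := by rw [h]
    rw [Set.mem_ofPred_eq, ← h1]
    omega

theorem level_ofLoops (L : ℕ → ℤ → ℤ) (N : ℕ) (hper : ∀ i, L i ∈ quasiPeriodic k n)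
    (hanti : ∀ i, Antitone (L i)) (hmono : Monotone L) (h0 : L 0 = mu)
    (hN : L N = shiftLoop lam d) (hle : ∀ i, L i ≤ shiftLoop lam d) :
    (ofLoops L N hper hanti hmono h0 hN).level = L := by
  set π := ofLoops L N hper hanti hmono h0 hN with hπ
  have key : ∀ (i : ℕ) (p : cylDiagram lam d mu), π.entry p < i ↔ p.1.2 ≤ L i p.1.1 := by
    intro i p
    have hmem : p.1.2 ≤ L (π.entry p + 1) p.1.1 :=
      Nat.sInf_mem (s := {i | p.1.2 ≤ L (i + 1) p.1.1})
        ⟨N, p.2.2.trans (hN ▸ hmono (Nat.le_succ N) p.1.1)⟩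
    constructor
    · exact fun h => hmem.trans (hmono h p.1.1)
    · intro h
      rcases i with _ | i
      · rw [h0] at h
        exact absurd p.2.1 (not_lt.mpr h)
      · exact Nat.lt_succ_of_le (Nat.sInf_le h)
  funext i a
  have h1 := π.le_level i a
  have h2 : mu a ≤ L i a := by rw [← h0]; exact hmono (Nat.zero_le i) a
  have h3 := π.level_le i a
  have h4 : L i a ≤ shiftLoop lam d a := hle i a
  apply le_antisymm
  · by_cases h : mu a < π.level i a
    · exact (key i ⟨(a, π.level i a), h, h3⟩).mp ((π.entry_lt_iff i _).mpr le_rfl)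
    · omega
  · by_cases h : mu a < L i a
    · exact (π.entry_lt_iff i ⟨(a, L i a), h, h4⟩).mp ((key i _).mpr le_rfl)
    · omega

end CylRPP

/-! ### Coefficients of cylindric complete symmetric functions -/

/-- Weakly increasing chains of `N + 1` weights that end in `q` (and stay there), the first `N` of
which sort to prescribed loops. -/
def weightChains (n N : ℕ) {k : ℕ} (L : ℕ → ℤ → ℤ) (q : Fin k → ℤ) : Set (ℕ → Fin k → ℤ) :=
  {P | (∀ i, N ≤ i → P i = q) ∧ ∀ i < N, P i ≤ P (i + 1) ∧ loopOf n (P i) = L i}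

/-- Prolonging a chain by one step. -/
def weightChainsSucc (n N : ℕ) {k : ℕ} (L : ℕ → ℤ → ℤ) (q : Fin k → ℤ) :
    (Σ p : {p : Fin k → ℤ | p ≤ q ∧ loopOf n p = L N}, weightChains n N L p.1) →
      weightChains n (N + 1) L q := fun P =>
  ⟨fun i => if i ≤ N then P.2.1 i else q, by
    obtain ⟨⟨p, hp, hL⟩, P, h1, h2⟩ := P
    have hPN : P N = p := h1 N le_rfl
    refine ⟨fun i hi => if_neg (by omega), fun i hi => ?_⟩
    rcases Nat.lt_succ_iff_lt_or_eq.mp hi with h | rfl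
    · simp only [if_pos h.le, if_pos (show i + 1 ≤ N from h)]
      exact h2 i h
    · simp only [if_pos le_rfl, if_neg (show ¬ i + 1 ≤ i by omega), hPN]
      exact ⟨hp, hL⟩⟩

theorem weightChainsSucc_bijective (n N : ℕ) {k : ℕ} (L : ℕ → ℤ → ℤ) (q : Fin k → ℤ) :
    Function.Bijective (weightChainsSucc n N L q) := by
  constructor
  · rintro ⟨⟨p, hp⟩, P, hP1, hP2⟩ ⟨⟨p', hp'⟩, P', hP1', hP2'⟩ h
    have h' : ∀ i ≤ N, P i = P' i := fun i hi => by
      have := congrFun (congrArg Subtype.val h) i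
      simpa [weightChainsSucc, hi] using this
    have e1 : P N = p := hP1 N le_rfl
    have e2 : P' N = p' := hP1' N le_rfl
    have e3 : P = P' := by
      funext i
      rcases le_total i N with hi | hi
      · exact h' i hi
      · rw [hP1 i hi, hP1' i hi, ← hP1 N le_rfl, ← hP1' N le_rfl]
        exact h' N le_rfl
    subst e3 e1 e2
    rfl
  · rintro ⟨P, h1, h2⟩
    refine ⟨⟨⟨P N, ?_, (h2 N (Nat.lt_succ_self N)).2⟩, fun i => if i ≤ N then P i else P N,
      fun i hi => ?_, fun i hi => ?_⟩, ?_⟩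
    · rw [← h1 (N + 1) le_rfl]
      exact (h2 N (Nat.lt_succ_self N)).1
    · simp only
      split_ifs with h
      · rw [le_antisymm h hi]
      · rfl
    · simp only [if_pos hi.le, if_pos (show i + 1 ≤ N from hi)]
      exact h2 i (by omega)
    · apply Subtype.ext
      funext i
      simp only [weightChainsSucc]
      split_ifs with h
      · rfl
      · exact (h1 i (by omega)).symm

theorem finite_le_loopOf_eq {k n : ℕ} (hk : 0 < k) (hn : 0 < n) (q : Fin k → ℤ) (M : ℤ → ℤ) :
    {p : Fin k → ℤ | p ≤ q ∧ loopOf n p = M}.Finite := by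
  apply (finite_le_conjOf_eq hn q (conjLoop M)).subset
  rintro p ⟨hp, rfl⟩
  exact ⟨hp, (conjLoop_loopOf hk hn p).symm⟩

/-- Remove the last step: there are `χ` choices for the penultimate weight `p`, and by induction the
number of chains ending in `p` depends only on the loop to which `p` sorts. So the counts multiply.
-/
theorem card_weightChains {k n : ℕ} (hk : 0 < k) (hn : 0 < n) {L : ℕ → ℤ → ℤ}
    (hL : ∀ i, L i ∈ quasiPeriodic k n) (ha : ∀ i, Antitone (L i)) (N : ℕ) (q : Fin k → ℤ)
    (hq : loopOf n q = L N) :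
    Finite (weightChains n N L q) ∧ (Nat.card (weightChains n N L q) : ℤ) =
      ∏ i ∈ Finset.range N, chi n (loopBase n (L (i + 1)))
        (loopDegree n (L (i + 1)) - loopDegree n (L i)) (loopBase n (L i)) := by
  induction N generalizing q with
  | zero =>
    have : weightChains n 0 L q = {fun _ => q} := by
      ext P
      simp [weightChains, funext_iff]
    rw [this]
    exact ⟨(Set.finite_singleton _).to_subtype, by simp⟩
  | succ N ih =>
    have hfin := finite_le_loopOf_eq hk hn q (L N)
    have := hfin.fintype
    have : ∀ p : {p : Fin k → ℤ | p ≤ q ∧ loopOf n p = L N}, Finite (weightChains n N L p.1) :=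
      fun p => (ih p.1 p.2.2).1
    have hb := weightChainsSucc_bijective n N L q
    refine ⟨Finite.of_surjective _ hb.2, ?_⟩
    rw [← Nat.card_eq_of_bijective _ hb, Nat.card_sigma, Finset.prod_range_succ,
      chi_eq_ncard hk hn (hL _) (ha _) (hL _) (ha _) hq]
    push_cast
    rw [Finset.sum_congr rfl fun p _ => (ih p.1 p.2.2).2, Finset.sum_const, nsmul_eq_mul, mul_comm,
      Finset.card_univ, ← Nat.card_eq_fintype_card, Nat.card_coe_set_eq]

theorem finsum_natCard_fiber {α β : Type*} [Finite α] (f : α → β) :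
    ∑ᶠ y, (Nat.card {x // f x = y} : ℤ) = Nat.card α := by
  classical
  have := Fintype.ofFinite α
  rw [finsum_eq_sum_of_support_subset (s := Finset.univ.image f)]
  · rw [Nat.card_eq_fintype_card, ← Finset.card_univ,
      Finset.card_eq_sum_card_image f Finset.univ]
    push_cast
    refine Finset.sum_congr rfl fun y _ => ?_
    rw [Nat.card_eq_fintype_card, Fintype.card_subtype]
  · intro y hy
    rw [Function.mem_support, Nat.cast_ne_zero, Nat.card_ne_zero] at hy
    obtain ⟨⟨x, rfl⟩⟩ := hy.1
    simp

/-- The matrices with `k` rows and column sums `θ` such that subtracting the row sums from `q`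
gives a weight that sorts to the loop `M`. -/
def orbitMatrices (n : ℕ) {k : ℕ} (M : ℤ → ℤ) (q : Fin k → ℤ) (θ : ℕ →₀ ℕ) :
    Set (Fin k →₀ (ℕ →₀ ℕ)) :=
  {l | ∑ j, l j = θ ∧ loopOf n (fun j => q j - (l j).degree) = M}

/-- The chain of weights ending in `q` whose steps are the columns of a matrix. -/
def columnChain {k : ℕ} (q : Fin k → ℤ) (N : ℕ) (l : Fin k →₀ (ℕ →₀ ℕ)) (i : ℕ) : Fin k → ℤ :=
  fun j => q j - ∑ m ∈ Finset.Ico i N, (l j m : ℤ)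

section columnChain

variable {k : ℕ} (q : Fin k → ℤ) (N : ℕ) (l : Fin k →₀ (ℕ →₀ ℕ))

theorem columnChain_of_le {i : ℕ} (hi : N ≤ i) : columnChain q N l i = q := by
  funext j
  simp [columnChain, hi]

theorem columnChain_succ_sub {i : ℕ} (hi : i < N) (j : Fin k) :
    columnChain q N l (i + 1) j - columnChain q N l i j = l j i := by
  rw [columnChain, columnChain, Finset.sum_eq_sum_Ico_succ_bot hi]
  ring

theorem columnChain_mono : Monotone (columnChain q N l) := by
  apply monotone_nat_of_le_succ
  intro i j
  rcases lt_or_ge i N with hi | hi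
  · have := columnChain_succ_sub q N l hi j
    exact sub_nonneg.mp (this ▸ Int.natCast_nonneg _)
  · rw [columnChain_of_le q N l hi, columnChain_of_le q N l (hi.trans (Nat.le_succ i))]

end columnChain

theorem apply_eq_zero_of_sum_eq {k : ℕ} {l : Fin k →₀ (ℕ →₀ ℕ)} {θ : ℕ →₀ ℕ}
    (hl : ∑ j, l j = θ) {m : ℕ} (hm : θ m = 0) (j : Fin k) : l j m = 0 := by
  have : ∑ j, l j m = 0 := by rw [← Finsupp.finsetSum_apply, hl, hm]
  exact Finset.sum_eq_zero_iff.mp this j (Finset.mem_univ j)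

theorem columnChain_zero {k : ℕ} {q : Fin k → ℤ} {N : ℕ} {l : Fin k →₀ (ℕ →₀ ℕ)} {θ : ℕ →₀ ℕ}
    (hl : ∑ j, l j = θ) (hN : ∀ i, N ≤ i → θ i = 0) :
    columnChain q N l 0 = fun j => q j - ((l j).degree : ℤ) := by
  funext j
  rw [columnChain, Finsupp.degree_apply,
    Finset.sum_subset (s₁ := (l j).support) (s₂ := Finset.Ico 0 N)]
  · push_cast; rfl
  · intro m hm
    by_contra hc
    exact Finsupp.mem_support_iff.mp hm
      (apply_eq_zero_of_sum_eq hl (hN m (by simpa using hc)) j)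
  · intro m _ hm
    exact Finsupp.notMem_support_iff.mp hm

theorem finite_orbitMatrices (n : ℕ) {k : ℕ} (M : ℤ → ℤ) (q : Fin k → ℤ) (θ : ℕ →₀ ℕ) :
    (orbitMatrices n M q θ).Finite := by
  classical
  apply (Finset.finsuppAntidiag (Finset.univ : Finset (Fin k)) θ).finite_toSet.subset
  intro l hl
  simpa using hl.1

/-! ### Matrices distributed over reverse plane partitions -/

section fibers

variable {k n : ℕ} {lam : ℤ → ℤ} {d : ℤ} {mu : ℤ → ℤ} {q : Fin k → ℤ} {θ : ℕ →₀ ℕ} {N : ℕ}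

/-- The column chain increases and sorting is monotone, so the sorted chain is an increasing
sequence of loops from `mu` to `λ[d]`. Sorting preserves sums, so the weight is given by the column
sums. -/
theorem exists_level_eq (hk : 0 < k) (hn : 0 < n) (hq : loopOf n q = shiftLoop lam d)
    (hN : ∀ i, N ≤ i → θ i = 0) {l : Fin k →₀ (ℕ →₀ ℕ)} (hl : l ∈ orbitMatrices n mu q θ) :
    ∃ π : CylRPP k n lam d mu, (∀ i, π.weight i = θ i) ∧
      ∀ i, loopOf n (columnChain q N l i) = π.level i := by
  have hmono := columnChain_mono q N l
  have hend : ∀ i, N ≤ i → loopOf n (columnChain q N l i) = shiftLoop lam d := fun i hi => by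
    rw [columnChain_of_le q N l hi, hq]
  let L := fun i => loopOf n (columnChain q N l i)
  have hL : ∀ i, L i ∈ quasiPeriodic k n := fun i => loopOf_mem_quasiPeriodic hk hn _
  have ha : ∀ i, Antitone (L i) := fun i => loopOf_antitone hk hn _
  have hLm : Monotone L := fun i j hij => loopOf_mono hk hn (hmono hij)
  have h0 : L 0 = mu := by
    simp only [L]
    rw [columnChain_zero hl.1 hN]
    exact hl.2
  have hlev := CylRPP.level_ofLoops L N hL ha hLm h0 (hend N le_rfl) fun i => by
    rcases le_total N i with hi | hi
    · exact (hend i hi).le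
    · rw [← hend N le_rfl]; exact hLm hi
  refine ⟨_, fun i => ?_, fun i => (congrFun hlev i).symm⟩
  zify
  rw [CylRPP.weight_eq, hlev, sum_window_loopOf hk hn, sum_window_loopOf hk hn,
    ← Finset.sum_sub_distrib]
  rcases lt_or_ge i N with hi | hi
  · simp only [columnChain_succ_sub q N l hi]
    rw [← hl.1, Finsupp.finsetSum_apply]
    push_cast; rfl
  · rw [columnChain_of_le q N l hi, columnChain_of_le q N l (hi.trans (Nat.le_succ i)), hN i hi]
    simp

theorem image_columnChain (hk : 0 < k) (hn : 0 < n) (hlam : lam ∈ quasiPeriodic k n)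
    (hla : Antitone lam) (hmu : mu ∈ quasiPeriodic k n) (hma : Antitone mu)
    (hq : loopOf n q = shiftLoop lam d) (hN : ∀ i, N ≤ i → θ i = 0)
    (π : CylRPP k n lam d mu) (hπ : ∀ i, π.weight i = θ i) :
    columnChain q N '' {l | l ∈ orbitMatrices n mu q θ ∧
      ∀ i, loopOf n (columnChain q N l i) = π.level i} = weightChains n N π.level q := by
  have hlevN : ∀ i, N ≤ i → π.level i = shiftLoop lam d := fun i hi =>
    π.level_eq_of_weight_eq_zero hk hn hlam hla hmu hma fun j hj => by
      rw [hπ, hN j (hi.trans hj)]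
  ext P
  constructor
  · rintro ⟨l, ⟨-, hlev⟩, rfl⟩
    exact ⟨fun i hi => columnChain_of_le q N l hi,
      fun i _ => ⟨columnChain_mono q N l (Nat.le_succ i), hlev i⟩⟩
  · rintro ⟨h1, h2⟩
    have hlev : ∀ i, loopOf n (P i) = π.level i := fun i => by
      rcases lt_or_ge i N with hi | hi
      · exact (h2 i hi).2
      · rw [h1 i hi, hq, hlevN i hi]
    have hstep : ∀ i j, P i j ≤ P (i + 1) j := fun i j => by
      rcases lt_or_ge i N with hi | hi
      · exact (h2 i hi).1 j
      · rw [h1 i hi, h1 (i + 1) (by omega)]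
    -- The differences are nonnegative by `hstep`, so `toNat` loses nothing; they vanish from `N`
    -- on, where the chain is constant.
    let l : Fin k →₀ (ℕ →₀ ℕ) := Finsupp.equivFunOnFinite.symm fun j =>
      Finsupp.onFinset (Finset.range N) (fun m => (P (m + 1) j - P m j).toNat) fun m hm => by
        by_contra hc
        rw [Finset.mem_range, not_lt] at hc
        rw [h1 m hc, h1 (m + 1) (by omega)] at hm
        simp at hm
    have hlapp : ∀ j m, (l j m : ℤ) = P (m + 1) j - P m j := fun j m => by
      have := hstep m j
      simp only [l, Finsupp.equivFunOnFinite_symm_apply_apply, Finsupp.onFinset_apply]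
      omega
    have hchain : columnChain q N l = P := by
      funext i j
      simp only [columnChain, hlapp]
      rcases le_total i N with hi | hi
      · rw [Finset.sum_Ico_sub (fun m => P m j) hi, h1 N le_rfl]
        ring
      · rw [Finset.Ico_eq_empty (by omega), h1 i hi]
        simp
    have hsum : ∑ j, l j = θ := by
      ext m
      rw [Finsupp.finsetSum_apply]
      zify
      rw [← hπ, CylRPP.weight_eq, ← hlev, ← hlev,
        sum_window_loopOf hk hn, sum_window_loopOf hk hn, ← Finset.sum_sub_distrib]
      exact Finset.sum_congr rfl fun j _ => hlapp j m
    refine ⟨l, ⟨⟨hsum, ?_⟩, fun i => ?_⟩, hchain⟩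
    · rw [← columnChain_zero hsum hN, hchain, hlev, π.level_zero]
    · rw [hchain, hlev]

theorem injOn_columnChain (hN : ∀ i, N ≤ i → θ i = 0) (M : ℤ → ℤ) :
    Set.InjOn (columnChain q N) (orbitMatrices n M q θ) := by
  intro l hl l' hl' h
  ext j m
  rcases lt_or_ge m N with hm | hm
  · zify
    rw [← columnChain_succ_sub q N l hm, ← columnChain_succ_sub q N l' hm, h]
  · rw [apply_eq_zero_of_sum_eq hl.1 (hN m hm), apply_eq_zero_of_sum_eq hl'.1 (hN m hm)]

theorem chiWeight_eq (hk : 0 < k) (hn : 0 < n) (hlam : lam ∈ quasiPeriodic k n)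
    (hla : Antitone lam) (hmu : mu ∈ quasiPeriodic k n) (hma : Antitone mu)
    (hq : loopOf n q = shiftLoop lam d) {π : CylRPP k n lam d mu}
    (hN : ∀ i, N ≤ i → π.weight i = 0) :
    π.chiWeight = Nat.card (weightChains n N π.level q) := by
  have hlevN : ∀ i, N ≤ i → π.level i = shiftLoop lam d := fun i hi =>
    π.level_eq_of_weight_eq_zero hk hn hlam hla hmu hma fun j hj => hN j (hi.trans hj)
  have hL := π.level_mem_quasiPeriodic hlam hmu
  have ha := π.level_antitone hla hma
  rw [(card_weightChains hk hn hL ha N q (by rw [hq, hlevN N le_rfl])).2, CylRPP.chiWeight]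
  apply finprod_eq_prod_of_mulSupport_subset
  intro i hi
  by_contra hc
  have hc' : N ≤ i := by simpa using hc
  apply hi
  beta_reduce
  rw [chi_eq_ncard (q := q) hk hn (hL _) (ha _) (hL _) (ha _)
    (by rw [hq, hlevN (i + 1) (by omega)])]
  -- Beyond `N` the loop no longer changes, and a weight below `q` that sorts to the same loop has
  -- the same sum as `q`, hence equals `q`. The factor is therefore `1`.
  have : {p : Fin k → ℤ | p ≤ q ∧ loopOf n p = π.level i} = {q} := by
    ext p
    simp only [Set.mem_ofPred_eq, Set.mem_singleton_iff]
    constructor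
    · rintro ⟨hp, he⟩
      have hs : ∑ j, p j = ∑ j, q j := by
        rw [← sum_window_loopOf hk hn p, ← sum_window_loopOf hk hn q, he, hq, hlevN i hc']
      funext j
      exact (Finset.sum_eq_sum_iff_of_le fun j _ => hp j).mp hs j (Finset.mem_univ j)
    · rintro rfl
      exact ⟨le_rfl, by rw [hq, hlevN i hc']⟩
  rw [this, Set.ncard_singleton]
  rfl

/-- The coefficients of the cylindric complete symmetric functions count matrices. -/
theorem coeff_cylindricH (hk : 0 < k) (hn : 0 < n) (hlam : lam ∈ quasiPeriodic k n)
    (hla : Antitone lam) (hmu : mu ∈ quasiPeriodic k n) (hma : Antitone mu)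
    (hq : loopOf n q = shiftLoop lam d) (θ : ℕ →₀ ℕ) :
    MvPowerSeries.coeff θ (cylindricH k n lam d mu) = (orbitMatrices n mu q θ).ncard := by
  obtain ⟨N, hN⟩ : ∃ N, ∀ i, N ≤ i → θ i = 0 := by
    refine ⟨θ.support.sup id + 1, fun i hi => ?_⟩
    by_contra hc
    have := Finset.le_sup (f := id) (Finsupp.mem_support_iff.mpr hc)
    simp only [id] at this
    omega
  -- Each matrix determines a reverse plane partition `f l` through its column chain; the fibre of
  -- `f` over `π` has `χ_π` elements.
  have hex : ∀ l : orbitMatrices n mu q θ, ∃ π : {π : CylRPP k n lam d mu //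
      ∀ i, π.weight i = θ i}, ∀ i, loopOf n (columnChain q N l.1 i) = π.1.level i := fun l => by
    obtain ⟨π, h1, h2⟩ := exists_level_eq hk hn hq hN l.2
    exact ⟨⟨π, h1⟩, h2⟩
  choose f hf using hex
  have := (finite_orbitMatrices n mu q θ).to_subtype
  rw [← Nat.card_coe_set_eq, ← finsum_natCard_fiber f]
  change ∑ᶠ π : {π : CylRPP k n lam d mu // ∀ i, π.weight i = θ i}, π.1.chiWeight = _
  refine finsum_congr fun π => ?_
  rw [chiWeight_eq hk hn hlam hla hmu hma hq (fun i hi => by rw [π.2, hN i hi]),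
    Nat.card_coe_set_eq, ← image_columnChain hk hn hlam hla hmu hma hq hN π.1 π.2,
    ((injOn_columnChain hN mu).mono fun l hl => hl.1).ncard_image]
  norm_cast
  rw [← Nat.card_coe_set_eq]
  refine Nat.card_congr
    { toFun := fun l => ⟨⟨l.1, l.2.1⟩, Subtype.ext (CylRPP.ext_level (funext fun i => ?_))⟩
      invFun := fun l => ⟨l.1.1, l.1.2, fun i => ?_⟩
      left_inv := fun l => rfl
      right_inv := fun l => rfl }
  · rw [← hf, l.2.2]
  · rw [hf, l.2]

end fibers

/-! ### Minimal coset representatives -/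

/-- The inversions between unequal values of `μ ∘ w` depend only on `μ ∘ w`, hence on the coset.
Only the inversions among ties can be minimised. -/
theorem permLength_eq_add {k : ℕ} {μ : Fin k → ℤ} (hμ : Antitone μ) (w : Equiv.Perm (Fin k)) :
    permLength w =
      (Finset.univ.filter fun p : Fin k × Fin k => p.1 < p.2 ∧ (μ ∘ w) p.1 < (μ ∘ w) p.2).card +
      (Finset.univ.filter fun p : Fin k × Fin k =>
        p.1 < p.2 ∧ (μ ∘ w) p.1 = (μ ∘ w) p.2 ∧ w p.2 < w p.1).card := by
  rw [permLength, ← Finset.card_union_of_disjoint]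
  · congr 1
    ext ⟨i, j⟩
    simp only [Finset.mem_filter, Finset.mem_univ, true_and, Finset.mem_union, Function.comp]
    constructor
    · rintro ⟨h1, h2⟩
      rcases eq_or_lt_of_le (hμ h2.le) with h | h
      · exact Or.inr ⟨h1, h, h2⟩
      · exact Or.inl ⟨h1, h⟩
    · rintro (⟨h1, h⟩ | ⟨h1, -, h2⟩)
      · exact ⟨h1, not_le.mp fun h2 => absurd (hμ h2) (not_le.mpr h)⟩
      · exact ⟨h1, h2⟩
  · rw [Finset.disjoint_filter]
    rintro p - ⟨-, h⟩ ⟨-, h', -⟩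
    exact h.ne h'

/-- The inverse of the stable sort lies in the same coset and has no inversions among ties. A
minimal `w` then has none either, and this property characterises the stable sort. -/
theorem inv_eq_sort_of_mem_minCosetReps {k : ℕ} {μ : Fin k → ℤ} (hμ : Antitone μ)
    {w : Equiv.Perm (Fin k)} (hw : w ∈ minCosetReps μ) :
    w⁻¹ = Tuple.sort (OrderDual.toDual ∘ (μ ∘ w)) := by
  set f := OrderDual.toDual ∘ (μ ∘ w) with hf
  have hfw : f ∘ ⇑(w⁻¹) = OrderDual.toDual ∘ μ := by
    funext i
    simp [hf]
  have hmono : Monotone (f ∘ ⇑(w⁻¹)) := by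
    rw [hfw]
    exact fun _ _ h => hμ h
  have hsort : f ∘ ⇑(w⁻¹) = f ∘ Tuple.sort f := Tuple.comp_sort_eq_comp_iff_monotone.mpr hmono
  set u := (Tuple.sort f)⁻¹ with hu
  have huμ : μ ∘ u = μ ∘ w := by
    funext i
    have := congrFun hsort (u i)
    rw [hfw] at this
    simpa [hf, hu] using this
  have hle : permLength w ≤ permLength u := by
    have := hw (u * w⁻¹) (by
      funext i
      have := congrFun huμ (w⁻¹ i)
      simpa using this)
    simpa using this
  rw [permLength_eq_add hμ, permLength_eq_add hμ u, huμ] at hle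
  have hu0 : (Finset.univ.filter fun p : Fin k × Fin k =>
      p.1 < p.2 ∧ (μ ∘ w) p.1 = (μ ∘ w) p.2 ∧ u p.2 < u p.1) = ∅ := by
    rw [Finset.filter_eq_empty_iff]
    rintro ⟨i, j⟩ - ⟨h1, h2, h3⟩
    have hsu : ∀ i, Tuple.sort f (u i) = i := fun i => by simp [hu]
    have hfe : f j = f i := congrArg OrderDual.toDual h2.symm
    have := (Tuple.eq_sort_iff.mp (rfl : Tuple.sort f = Tuple.sort f)).2 _ _ h3 (by
      simpa only [hsu] using hfe)
    simp only [hsu] at this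
    exact absurd h1 (not_lt.mpr this.le)
  rw [hu0, Finset.card_empty, add_zero, add_le_iff_nonpos_right, Nat.le_zero_eq,
    Finset.card_eq_zero, Finset.filter_eq_empty_iff] at hle
  refine Tuple.eq_sort_iff.mpr ⟨hmono, fun i j hij he => ?_⟩
  by_contra hc
  have hlt : w⁻¹ j < w⁻¹ i :=
    lt_of_le_of_ne (not_lt.mp hc) fun h => hij.ne' (w⁻¹.injective h)
  refine hle (Finset.mem_univ (w⁻¹ j, w⁻¹ i)) ⟨hlt, ?_, by simpa using hij⟩
  simpa [hf] using he.symm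

theorem minCosetReps_injOn {k : ℕ} {μ : Fin k → ℤ} (hμ : Antitone μ) :
    Set.InjOn (fun w : Equiv.Perm (Fin k) => μ ∘ w) (minCosetReps μ) := by
  intro w hw w' hw' h
  have h' : μ ∘ w = μ ∘ w' := h
  rw [← inv_inj, inv_eq_sort_of_mem_minCosetReps hμ hw, inv_eq_sort_of_mem_minCosetReps hμ hw', h']

theorem exists_mem_minCosetReps {k : ℕ} (μ : Fin k → ℤ) (w : Equiv.Perm (Fin k)) :
    ∃ u ∈ minCosetReps μ, μ ∘ u = μ ∘ w := by
  obtain ⟨u, hu, hmin⟩ := Set.exists_min_image {u : Equiv.Perm (Fin k) | μ ∘ u = μ ∘ w} permLength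
    (Set.toFinite _) ⟨w, rfl⟩
  refine ⟨u, fun v hv => hmin _ ?_, hu⟩
  have hv' : μ ∘ v = μ := hv
  rw [Set.mem_ofPred_eq, Equiv.Perm.coe_mul, ← Function.comp_assoc, hv']
  exact hu

/-! ### Orbits of the extended affine symmetric group -/

theorem exists_perm_of_card_fiber_eq {ι α : Type*} [Fintype ι] [DecidableEq α] {f g : ι → α}
    (h : ∀ a, (Finset.univ.filter fun i => f i = a).card =
      (Finset.univ.filter fun i => g i = a).card) :
    ∃ e : Equiv.Perm ι, g ∘ e = f := by
  have hne : ∀ a, Nonempty ({i // f i = a} ≃ {i // g i = a}) := fun a => by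
    rw [← Fintype.card_eq, Fintype.card_subtype, Fintype.card_subtype]
    exact h a
  refine ⟨(Equiv.sigmaFiberEquiv f).symm.trans
    ((Equiv.sigmaCongrRight fun a => (hne a).some).trans (Equiv.sigmaFiberEquiv g)),
    funext fun i => ?_⟩
  exact ((hne (f i)).some ⟨i, rfl⟩).2

theorem conjOf_add_mul {n : ℕ} (hn : 0 < n) {k : ℕ} (p β : Fin k → ℤ) (j : ℤ) :
    conjOf n (fun i => p i + n * β i) j = conjOf n p j + ∑ i, β i := by
  rw [conjOf, conjOf, ← Finset.sum_add_distrib]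
  refine Finset.sum_congr rfl fun i _ => ?_
  rw [show p i + n * β i - j = p i - j + n * β i by ring,
    Int.add_mul_ediv_left _ _ (by omega)]
  ring

theorem conjOf_comp_perm (n : ℕ) {k : ℕ} (p : Fin k → ℤ) (w : Equiv.Perm (Fin k)) :
    conjOf n (p ∘ w) = conjOf n p := by
  funext j
  exact Equiv.sum_comp w fun i => (p i - j) / (n : ℤ) + 1

theorem conjOf_succ_of_mem_Icc {n : ℕ} (hn : 0 < n) {k : ℕ} {p : Fin k → ℤ}
    (hp : ∀ i, p i ∈ Finset.Icc (1 : ℤ) n) : conjOf n p (n + 1) = 0 := by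
  refine Finset.sum_eq_zero fun i _ => ?_
  have := Finset.mem_Icc.mp (hp i)
  rw [show p i - (n + 1) = p i - 1 + n * (-1) by ring,
    Int.add_mul_ediv_left _ _ (by omega), Int.ediv_eq_zero_of_lt (by omega) (by omega)]
  ring

theorem card_fiber_eq {n : ℕ} (hn : 0 < n) {k : ℕ} {p : Fin k → ℤ}
    (hp : ∀ i, p i ∈ Finset.Icc (1 : ℤ) n) {j : ℤ} (hj : j ∈ Finset.Icc (1 : ℤ) n) :
    ((Finset.univ.filter fun i => p i = j).card : ℤ) = conjOf n p j - conjOf n p (j + 1) := by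
  rw [conjOf_sub_succ hn, Finset.card_filter]
  push_cast
  refine Finset.sum_congr rfl fun i _ => if_congr ?_ rfl rfl
  have := dvd_sub_iff_eq (t := 0) (hp i) hj
  simp only [mul_zero, add_zero] at this
  rw [this, eq_comm]

/-- Reduce `p` modulo `n` to representatives in `1, …, n`. The successive differences of the
conjugate are the multiplicities of these representatives, and a tuple is determined by its
multiplicities up to permutation. -/
theorem conjOf_eq_iff {n : ℕ} (hn : 0 < n) {k : ℕ} {p μ : Fin k → ℤ}
    (hμ : ∀ i, μ i ∈ Finset.Icc (1 : ℤ) n) :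
    conjOf n p = conjOf n μ ↔ ∃ (w : Equiv.Perm (Fin k)) (β : Fin k → ℤ),
      ∑ i, β i = 0 ∧ μ ∘ w = fun i => p i + n * β i := by
  constructor
  · intro h
    choose r hr t ht using fun i => exists_residue hn (p i)
    obtain rfl : p = fun i => r i + n * t i := funext ht
    -- At `n + 1` the conjugate of a tuple with entries in `1, …, n` is zero, so only the
    -- translation part survives.
    have ht0 : ∑ i, t i = 0 := by
      have := congrFun h (n + 1)
      rw [conjOf_add_mul hn, conjOf_succ_of_mem_Icc hn hr, conjOf_succ_of_mem_Icc hn hμ] at this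
      linarith
    have hrμ : conjOf n r = conjOf n μ := by
      rw [← h]
      funext j
      rw [conjOf_add_mul hn, ht0, add_zero]
    obtain ⟨e, he⟩ := exists_perm_of_card_fiber_eq (f := r) (g := μ) fun j => by
      by_cases hj : j ∈ Finset.Icc (1 : ℤ) n
      · zify
        rw [card_fiber_eq hn hr hj, card_fiber_eq hn hμ hj, hrμ]
      · rw [Finset.filter_false_of_mem fun i _ (h : r i = j) => hj (h ▸ hr i),
          Finset.filter_false_of_mem fun i _ (h : μ i = j) => hj (h ▸ hμ i)]
    refine ⟨e, fun i => -t i, by simp [ht0], ?_⟩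
    rw [he]
    funext i
    ring
  · rintro ⟨w, β, hβ, h⟩
    rw [← conjOf_comp_perm n μ w, h]
    funext j
    rw [conjOf_add_mul hn, hβ, add_zero]

theorem window_mem_Icc {k n : ℕ} (hk : 0 < k) {mu : ℤ → ℤ} (hmu : mu ∈ alcove k n) (i : Fin k) :
    window k mu i ∈ Finset.Icc (1 : ℤ) n := by
  have ha := alcove_antitone hk hmu
  obtain ⟨-, h1, -, h3⟩ := hmu
  have hi := i.2
  have e1 : window k mu i ≤ mu 1 := ha (show (1 : ℤ) ≤ (i : ℤ) + 1 by omega)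
  have e2 : mu k ≤ window k mu i := ha (show (i : ℤ) + 1 ≤ k by omega)
  exact Finset.mem_Icc.mpr ⟨by omega, by omega⟩

theorem window_antitone {k : ℕ} {mu : ℤ → ℤ} (ha : Antitone mu) : Antitone (window k mu) :=
  fun i j h => ha (by have : (i : ℕ) ≤ j := h; omega)

theorem loopOf_eq_iff_exists {k n : ℕ} (hk : 0 < k) (hn : 0 < n) {mu : ℤ → ℤ}
    (hmu : mu ∈ alcove k n) (p : Fin k → ℤ) :
    loopOf n p = mu ↔ ∃ (w : Equiv.Perm (Fin k)) (β : Fin k → ℤ),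
      ∑ i, β i = 0 ∧ window k mu ∘ w = fun i => p i + n * β i := by
  have ha := alcove_antitone hk hmu
  rw [loopOf_eq_iff hk hn hmu.1 ha, conjLoop_eq_conjOf hk hn hmu.1 ha,
    conjOf_eq_iff hn (window_mem_Icc hk hmu)]

/-- `fusionN` counts the rearrangements of `ν` whose difference from a weight in the orbit of
`λ[d]` lies in the orbit of `μ`. -/
theorem fusionN_eq {k n : ℕ} (hk : 0 < k) (hn : 0 < n) {lam mu : ℤ → ℤ}
    (hlam : lam ∈ alcove k n) (hmu : mu ∈ alcove k n) {d : ℤ} {α : Fin k → ℤ}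
    (hα : ∑ i, α i = d) {ν : Fin k → ℕ} (hν : Antitone ν) :
    fusionN k lam d mu ν = {x : Fin k → ℕ | (∃ w : Equiv.Perm (Fin k), x = ν ∘ w) ∧
      loopOf n (fun i => window k lam i + n * α i - x i) = mu}.ncard := by
  have hνanti : Antitone fun i => (ν i : ℤ) := fun i j h => Int.ofNat_le.mpr (hν h)
  -- A pair `(w, w')` is recorded by the rearrangement `ν ∘ w'` alone.
  rw [fusionN, ← Set.InjOn.ncard_image (f := fun p => ν ∘ p.2)]
  · congr 1
    ext x
    constructor
    · rintro ⟨⟨w, w'⟩, ⟨hw, hw', β, hβ, he⟩, rfl⟩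
      refine ⟨⟨w', rfl⟩, (loopOf_eq_iff_exists hk hn hmu _).mpr
        ⟨w, fun i => β i - α i, by simp [hα, hβ], ?_⟩⟩
      funext i
      have := congrFun he i
      rw [window_comp_yPow hlam.1] at this
      simp only [Pi.add_apply, Function.comp] at this ⊢
      linear_combination this
    · rintro ⟨⟨w', rfl⟩, h⟩
      obtain ⟨w, β, hβ, he⟩ := (loopOf_eq_iff_exists hk hn hmu _).mp h
      obtain ⟨u, hu, hue⟩ := exists_mem_minCosetReps (window k mu) w
      obtain ⟨u', hu', hue'⟩ := exists_mem_minCosetReps (fun i => (ν i : ℤ)) w'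
      refine ⟨(u, u'), ⟨hu, hu', fun i => α i + β i, by simp [Finset.sum_add_distrib, hα, hβ], ?_⟩,
        ?_⟩
      · funext i
        rw [window_comp_yPow hlam.1]
        have h1 := congrFun he i
        have h2 := congrFun hue i
        have h3 := congrFun hue' i
        simp only [Pi.add_apply, Function.comp] at h1 h2 h3 ⊢
        linear_combination h1 + h2 + h3
      · funext i
        have := congrFun hue' i
        simpa using this
  · rintro ⟨w, w'⟩ ⟨hw, hw', β, hβ, he⟩ ⟨u, u'⟩ ⟨hu, hu', γ, hγ, he'⟩ h
    simp only at hw hw' hu hu' he he' h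
    have h2 : w' = u' := minCosetReps_injOn hνanti hw' hu' (by
      funext i
      have := congrFun h i
      simp only [Function.comp] at this ⊢
      rw [this])
    subst h2
    -- Once `ν ∘ w'` is fixed, `μ ∘ w` is known modulo `n`, and its entries lie in `1, …, n`, so it
    -- is determined; then so is `w`.
    have h1 : w = u := minCosetReps_injOn (window_antitone (alcove_antitone hk hmu)) hw hu (by
      funext i
      have e1 := congrFun he i
      have e2 := congrFun he' i
      rw [window_comp_yPow hlam.1] at e1 e2
      simp only [Pi.add_apply, Function.comp] at e1 e2 ⊢
      have e3 := dvd_sub_iff_eq (t := β i - γ i) (window_mem_Icc hk hmu (u i))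
        (window_mem_Icc hk hmu (w i))
      refine e3.mp ⟨0, ?_⟩
      linear_combination e2 - e1)
    rw [h1]

theorem fusionN_ne_zero {k n : ℕ} {lam mu : ℤ → ℤ} (hlam : lam ∈ quasiPeriodic k n) {d : ℤ}
    {ν : Fin k → ℕ} (h : fusionN k lam d mu ν ≠ 0) :
    ∑ i, (ν i : ℤ) = n * d + weightSize k lam - weightSize k mu := by
  obtain ⟨⟨w, w'⟩, -, -, α, hα, he⟩ := Set.nonempty_of_ncard_ne_zero h
  have := Finset.sum_congr rfl fun i (_ : i ∈ Finset.univ) => congrFun he i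
  simp only [Pi.add_apply, Function.comp, window_comp_yPow hlam, Finset.sum_add_distrib,
    ← Finset.mul_sum, hα] at this
  rw [Equiv.sum_comp w (window k mu), Equiv.sum_comp w' fun i => (ν i : ℤ)] at this
  simp only [weightSize]
  linear_combination this

/-! ### Expansion into complete symmetric functions -/

/-- Expanding the product chooses one monomial from each factor; their exponent vectors are the rows
of a matrix with row sums `ν` and column sums `θ`. -/
theorem coeff_completeHProd {k : ℕ} (ν : Fin k → ℕ) (θ : ℕ →₀ ℕ) :
    MvPowerSeries.coeff θ (completeHProd ν) =
      {l : Fin k →₀ (ℕ →₀ ℕ) | ∑ j, l j = θ ∧ ∀ j, (l j).degree = ν j}.ncard := by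
  classical
  have hcoeff : ∀ (r : ℕ) (η : ℕ →₀ ℕ), MvPowerSeries.coeff η (completeH r) =
    if η.degree = r then 1 else 0 := fun _ _ => rfl
  have hset : {l : Fin k →₀ (ℕ →₀ ℕ) | ∑ j, l j = θ ∧ ∀ j, (l j).degree = ν j} =
      ((Finset.finsuppAntidiag Finset.univ θ).filter fun l : Fin k →₀ (ℕ →₀ ℕ) =>
        ∀ j, (l j).degree = ν j : Finset _) := by
    ext l
    simp
  rw [completeHProd, MvPowerSeries.coeff_prod, hset, Set.ncard_coe_finset, Finset.card_filter]
  push_cast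
  refine Finset.sum_congr rfl fun l _ => ?_
  simp only [hcoeff]
  rw [Finset.prod_ite_zero]
  simp

theorem completeHProd_comp_perm {k : ℕ} (ν : Fin k → ℕ) (w : Equiv.Perm (Fin k)) :
    completeHProd (ν ∘ w) = completeHProd ν :=
  Equiv.prod_comp w fun i => completeH (ν i)

/-- The decreasing rearrangement of a tuple. -/
def sortDesc {k : ℕ} (x : Fin k → ℕ) : Fin k → ℕ := x ∘ Tuple.sort (OrderDual.toDual ∘ x)

theorem sortDesc_antitone {k : ℕ} (x : Fin k → ℕ) : Antitone (sortDesc x) :=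
  fun _ _ h => Tuple.monotone_sort (OrderDual.toDual ∘ x) h

theorem sortDesc_eq_iff {k : ℕ} {ν : Fin k → ℕ} (hν : Antitone ν) (x : Fin k → ℕ) :
    sortDesc x = ν ↔ ∃ w : Equiv.Perm (Fin k), x = ν ∘ w := by
  constructor
  · rintro rfl
    refine ⟨(Tuple.sort (OrderDual.toDual ∘ x))⁻¹, funext fun i => ?_⟩
    simp [sortDesc]
  · rintro ⟨w, rfl⟩
    refine Tuple.unique_antitone (f := ν) (σ := w * Tuple.sort (OrderDual.toDual ∘ (ν ∘ w)))
      (τ := 1) (sortDesc_antitone (ν ∘ w)) hν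

/-! ### Row sums and column permutations of matrices -/

section

variable {k n : ℕ} {M : ℤ → ℤ} {q : Fin k → ℤ} {θ : ℕ →₀ ℕ}

theorem finite_setOf_loopOf_sub (hk : 0 < k) (hn : 0 < n) (M : ℤ → ℤ) (q : Fin k → ℤ) :
    {x : Fin k → ℕ | loopOf n (fun i => q i - x i) = M}.Finite := by
  refine Set.Finite.of_finite_image ((finite_le_loopOf_eq hk hn q M).subset ?_)
    (f := fun x i => q i - (x i : ℤ)) ?_
  · rintro _ ⟨x, hx, rfl⟩
    exact ⟨fun i => sub_le_self _ (Int.natCast_nonneg _), hx⟩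
  · intro x _ y _ h
    funext i
    have := congrFun h i
    simp only at this
    omega

theorem sum_eq_of_loopOf_sub (hk : 0 < k) (hn : 0 < n) {x : Fin k → ℕ}
    (h : loopOf n (fun i => q i - x i) = M) :
    ∑ i, (x i : ℤ) = ∑ i, q i - weightSize k M := by
  rw [weightSize, ← h, sum_window_loopOf hk hn, Finset.sum_sub_distrib]
  ring

theorem ncard_orbitMatrices (hk : 0 < k) (hn : 0 < n) (M : ℤ → ℤ) (q : Fin k → ℤ) (θ : ℕ →₀ ℕ) :
    ((orbitMatrices n M q θ).ncard : ℤ) = ∑ x ∈ (finite_setOf_loopOf_sub hk hn M q).toFinset,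
      MvPowerSeries.coeff θ (completeHProd x) := by
  classical
  have hfin := finite_orbitMatrices n M q θ
  rw [Set.ncard_eq_toFinset_card _ hfin, Finset.card_eq_sum_card_fiberwise
    (f := fun l j => (l j).degree) (t := (finite_setOf_loopOf_sub hk hn M q).toFinset)]
  · push_cast
    refine Finset.sum_congr rfl fun x hx => ?_
    rw [coeff_completeHProd, ← Set.ncard_coe_finset]
    congr 2
    ext l
    simp only [Set.Finite.mem_toFinset, Set.mem_ofPred_eq] at hx
    simp only [Finset.coe_filter, Set.Finite.mem_toFinset, Set.mem_ofPred_eq, orbitMatrices,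
      funext_iff]
    constructor
    · rintro ⟨⟨h1, -⟩, h2⟩
      exact ⟨h1, h2⟩
    · rintro ⟨h1, h2⟩
      refine ⟨⟨h1, ?_⟩, h2⟩
      simp only [h2]
      exact fun a => congrFun hx a
  · intro l hl
    rw [Finset.mem_coe, Set.Finite.mem_toFinset] at hl ⊢
    exact hl.2

/-- Permuting the columns keeps the row sums, on which the orbit condition depends, and is
injective. Applying the same bound to `s⁻¹` will give equality. -/
theorem ncard_orbitMatrices_le (s : Equiv.Perm ℕ) :
    (orbitMatrices n M q θ).ncard ≤ (orbitMatrices n M q (θ.mapDomain s)).ncard := by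
  refine Set.ncard_le_ncard_of_injOn
    (fun l => l.mapRange (Finsupp.mapDomain s) Finsupp.mapDomain_zero) ?_ ?_
    (finite_orbitMatrices _ _ _ _)
  · rintro l ⟨h1, h2⟩
    constructor
    · simp only [Finsupp.mapRange_apply]
      rw [← h1]
      exact (map_sum (Finsupp.mapDomain.addMonoidHom s) _ _).symm
    · simp only [Finsupp.mapRange_apply, Finsupp.degree_mapDomain]
      exact h2
  · exact (Finsupp.mapRange_injective _ _ (Finsupp.mapDomain_injective s.injective)).injOn

theorem ncard_orbitMatrices_mapDomain (s : Equiv.Perm ℕ) :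
    (orbitMatrices n M q (θ.mapDomain s)).ncard = (orbitMatrices n M q θ).ncard := by
  refine le_antisymm ?_ (ncard_orbitMatrices_le s)
  have := ncard_orbitMatrices_le (n := n) (M := M) (q := q) (θ := θ.mapDomain s) s⁻¹
  rwa [← Finsupp.mapDomain_comp, ← Equiv.Perm.coe_mul, inv_mul_cancel, Equiv.Perm.coe_one,
    Finsupp.mapDomain_id] at this

theorem degree_of_mem_orbitMatrices (hk : 0 < k) (hn : 0 < n) {l : Fin k →₀ (ℕ →₀ ℕ)}
    (hl : l ∈ orbitMatrices n M q θ) : (θ.degree : ℤ) = ∑ i, q i - weightSize k M := by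
  rw [← sum_eq_of_loopOf_sub hk hn hl.2, ← hl.1, map_sum]
  push_cast
  rfl

end

theorem isSymmetricFunction_of_coeff {k n : ℕ} (hk : 0 < k) (hn : 0 < n) {M : ℤ → ℤ}
    {q : Fin k → ℤ} {f : MvPowerSeries ℕ ℤ}
    (hf : ∀ θ, MvPowerSeries.coeff θ f = (orbitMatrices n M q θ).ncard) :
    IsSymmetricFunction f := by
  refine ⟨⟨(∑ i, q i - weightSize k M).toNat, fun θ hθ => ?_⟩, fun s θ => ?_⟩
  · rw [hf, Nat.cast_eq_zero, Set.ncard_eq_zero (finite_orbitMatrices _ _ _ _),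
      Set.eq_empty_iff_forall_notMem]
    intro l hl
    have := degree_of_mem_orbitMatrices hk hn hl
    omega
  · rw [hf, hf, ncard_orbitMatrices_mapDomain]

theorem finite_positiveDominant_sum_eq (k : ℕ) (s : ℤ) :
    {ν : Fin k → ℕ | ν ∈ positiveDominant k ∧ ∑ i, (ν i : ℤ) = s}.Finite := by
  apply (Set.finite_Iic fun _ : Fin k => s.toNat).subset
  rintro ν ⟨-, rfl⟩ i
  have := Finset.single_le_sum (f := fun i => (ν i : ℤ)) (fun i _ => Int.natCast_nonneg _)
    (Finset.mem_univ i)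
  simp only at this ⊢
  omega

theorem loopOf_translate {k n : ℕ} (hk : 0 < k) (hn : 0 < n) {lam : ℤ → ℤ}
    (hlam : lam ∈ quasiPeriodic k n) (hla : Antitone lam) {d : ℤ} {α : Fin k → ℤ}
    (hα : ∑ i, α i = d) :
    loopOf n (fun i => window k lam i + n * α i) = shiftLoop lam d := by
  rw [loopOf_eq_iff hk hn (shiftLoop_mem_quasiPeriodic hlam d) (shiftLoop_antitone hla d)]
  funext j
  rw [conjOf_add_mul hn, hα, conjLoop_shiftLoop hn hlam hla, conjLoop_eq_conjOf hk hn hlam hla]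

end CylSymm

end

theorem mainTheorem1 (k n : ℕ) (hk : 0 < k) (hn : 0 < n) (lam mu : ℤ → ℤ)
    (hlam : lam ∈ CylSymm.alcove k n) (hmu : mu ∈ CylSymm.alcove k n) (d : ℕ) :
    CylSymm.IsSymmetricFunction (CylSymm.cylindricH k n lam d mu) ∧
    (∀ ν ∈ CylSymm.positiveDominant k, CylSymm.fusionN k lam d mu ν ≠ 0 →
      ∑ i, (ν i : ℤ) = n * d + CylSymm.weightSize k lam - CylSymm.weightSize k mu) ∧
    CylSymm.cylindricH k n lam d mu =
      ∑ᶠ ν ∈ {ν : Fin k → ℕ | ν ∈ CylSymm.positiveDominant k ∧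
        ∑ i, (ν i : ℤ) = n * d + CylSymm.weightSize k lam - CylSymm.weightSize k mu},
        (CylSymm.fusionN k lam d mu ν : ℤ) • CylSymm.completeHProd ν := by
  classical
  have hla := CylSymm.alcove_antitone hk hlam
  have hma := CylSymm.alcove_antitone hk hmu
  -- Any translation of total size `d` will do, since all the weights `λ + n α` sort to `λ[d]`; here
  -- it is concentrated in one coordinate.
  obtain ⟨α, hα⟩ : ∃ α : Fin k → ℤ, ∑ i, α i = d :=
    ⟨Pi.single ⟨0, hk⟩ (d : ℤ), Finset.univ.sum_pi_single' _ _ |>.trans (by simp)⟩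
  set q : Fin k → ℤ := fun i => CylSymm.window k lam i + n * α i with hq
  have hcoeff := CylSymm.coeff_cylindricH hk hn hlam.1 hla hmu.1 hma
    (CylSymm.loopOf_translate hk hn hlam.1 hla hα)
  refine ⟨CylSymm.isSymmetricFunction_of_coeff hk hn hcoeff,
    fun ν _ h => CylSymm.fusionN_ne_zero hlam.1 h, ?_⟩
  have hqsum : ∑ i, q i = n * d + CylSymm.weightSize k lam := by
    simp only [hq, Finset.sum_add_distrib, ← Finset.mul_sum, hα, CylSymm.weightSize]
    ring
  rw [finsum_mem_eq_finite_toFinset_sum _ (CylSymm.finite_positiveDominant_sum_eq k _)]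
  ext θ
  -- The sum of `h_x` over admissible row sums is grouped by decreasing rearrangement, under which
  -- `h_x` is invariant; the size of each fibre is `fusionN`.
  rw [hcoeff, CylSymm.ncard_orbitMatrices hk hn, map_sum,
    ← Finset.sum_fiberwise_of_maps_to (g := CylSymm.sortDesc) (t := Set.Finite.toFinset
      (CylSymm.finite_positiveDominant_sum_eq k _))]
  · refine Finset.sum_congr rfl fun ν hν => ?_
    rw [Set.Finite.mem_toFinset] at hν
    rw [Finset.sum_congr rfl (g := fun _ => MvPowerSeries.coeff θ (CylSymm.completeHProd ν)),
      Finset.sum_const, CylSymm.fusionN_eq hk hn hlam hmu hα hν.1, map_zsmul, smul_eq_mul,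
      nsmul_eq_mul, ← Set.ncard_coe_finset]
    · congr 3
      ext x
      simp only [Finset.coe_filter, Set.Finite.mem_toFinset, Set.mem_ofPred_eq,
        CylSymm.sortDesc_eq_iff hν.1]
      exact and_comm
    · intro x hx
      rw [Finset.mem_filter] at hx
      rw [← hx.2, CylSymm.sortDesc, CylSymm.completeHProd_comp_perm]
  · intro x hx
    rw [Set.Finite.mem_toFinset] at hx ⊢
    refine ⟨CylSymm.sortDesc_antitone x, ?_⟩
    rw [CylSymm.sortDesc, ← hqsum, ← CylSymm.sum_eq_of_loopOf_sub hk hn hx]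
    exact Equiv.sum_comp _ fun i => (x i : ℤ)
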